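/- Let $n\ge 3$, $k\ge 2$. The $n$-dimensional Rubik's cube with edge length $k$ is the cube $[0,k]^n$ cut into $k^n$ unit cubies. *Puzzle.* A position of a cubie is a product $A_1\times\dots\times A_n$ of segments $E_j=[j,j+1]$, $0\le j\le k-1$. It lies in the trivial class $(m)$ if exactly $m$ of its factors are $E_0$ or $E_{k-1}$. An orientation face of a cubie of the trivial class $(m)$ is an $(n+1-m)$-dimensional face of it obtained by replacing $m-1$ of its outer factors $E_0$, $E_{k-1}$ by the boundary points $\{0\}$, $\{k\}$ respectively; for $m\ge1$ there are exactly $m$ of them, and for $m=0$ there are none. A layer consists of all cubies for which the factors of the position outside a given set $T$ of coordinates have prescribed values. A turn of the layer in the plane of two coordinates $i\ne j$ of $T$ replaces, for every cubie of the layer and for its orientation faces, the factors $A_i, A_j$ by $\overline{A_j}, A_i$, where $\overline{A}=\{k-x: x\in A\}$; all other factors and all other cubies stay. A combination is a finite sequence of turns. The state of a cubie is its position together with the positions of its orientation faces. Two cubies belong to one class if some combination takes the first one to the position of the second one. *Orientation.* Number the orientation faces of every cubie of the trivial class $(m)$ by $1,\dots,m$, and fix for every position in $(m)$ a correct orientation,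 i.e. a numbering by $1,\dots,m$ of the positions of orientation faces there. In a given state of the puzzle (any arrangement in which each cubie of $(m)$ stands in a position of $(m)$ with its orientation faces placed, in any order, on the orientation faces of that position) the orientation permutation $\varphi\in S_m$ of a cubie is defined by: $\varphi(j)$ is the number of the face that is now where the face number $j$ should be. The dependent rotation group $\overline G_{rot}\le S_m$ of a cubie is the group generated by the permutations of its orientation faces effected by combinations that return the cubie to its position. *Careful combinations.* A combination is a careful orientation combination of a set $X$ of cubies (in a given state of the puzzle) if it does not change the positions of the cubies of $X$ and does not change the states of all other cubies. (It need not be non-trivial on the cubies of $X$.) **Theorem.** Let an arbitrary state of the puzzle, numbering of faces and choice of correct orientations be given; let $\varphi$ and $\varphi'$ denote the orientation permutations of a cubie before and after a combination. 1. For any two distinct cubies $a,b$ of one class and any $z\in\overline G_{rot}$ (the group of $a$) there is a careful orientation combination of $\{a,b\}$ after which the cubie $a$ has $$\varphi'=z\cdot\varphi .$$ 2. For any cubie $a$ and any $z$ in the commutator subgroup $[\overline G_{rot},\overline G_{rot}]$ of its dependent group there is a careful orientation combination of $\{a\}$ after which $$\varphi'=z\cdot\varphi .$$ -/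

import Mathlib

namespace Rubik

/-! The `n`-dimensional Rubik's cube with edge length `k`: the cube `[0,k]ⁿ` cut into `kⁿ` unit
cubies.  The segment `[j, j+1]`, `0 ≤ j < k`, is recorded by `j : Fin k`. -/

/-- A position of a cubie: the unit cube `∏ᵢ [p i, p i + 1]`. -/
abbrev Pos (n k : ℕ) : Type := Fin n → Fin k

/-- One factor in the product notation of a face: a unit segment `[j, j+1]`, or one of the
boundary points `{0}` and `{k}`. -/
inductive Cell (k : ℕ) : Type
  | seg (j : Fin k)
  | bot
  | top

/-- The image of a cell under `x ↦ k - x`. -/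
def Cell.opp {k : ℕ} : Cell k → Cell k
  | .seg j => .seg j.rev
  | .bot => .top
  | .top => .bot

/-- The cell is a segment. -/
def Cell.IsSeg {k : ℕ} : Cell k → Prop
  | .seg _ => True
  | .bot => False
  | .top => False

/-- The segment `[a, a+1]` touches the boundary of `[0, k]`. -/
def IsOuter {k : ℕ} (a : Fin k) : Prop := (a : ℕ) = 0 ∨ (a : ℕ) + 1 = k

/-- The cell is the segment `[a, a+1]`, or an end point of it that is a boundary point
of `[0, k]`. -/
def Cell.Fits {k : ℕ} (a : Fin k) : Cell k → Prop
  | .seg j => j = a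
  | .bot => (a : ℕ) = 0
  | .top => (a : ℕ) + 1 = k

open Classical in
/-- The number of coordinates in which a sequence has the property `P`. -/
noncomputable def count {n : ℕ} {α : Type} (P : α → Prop) (A : Fin n → α) : ℕ :=
  (Finset.univ.filter fun x => P (A x)).card

/-- `m`, the number of factors `[0,1]` or `[k-1,k]` in the position of a cubie. -/
noncomputable def outerCount {n k : ℕ} (p : Pos n k) : ℕ := count IsOuter p

/-- The trivial class `(m)`: the positions with exactly `m` factors `[0,1]` or `[k-1,k]`. -/
abbrev TrivClass (n k m : ℕ) : Type := {p : Pos n k // outerCount p = m}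

/-- `A` is the position of an orientation face of the cubie in position `p`: an outer face of the
cubie (some of its factors `[0,1]`, `[k-1,k]` are replaced by `{0}`, `{k}`) whose dimension (its
number of segments) is `n + 1 - m`, where `m` is the number of outer factors of `p`. -/
def IsOrientationFace {n k : ℕ} (p : Pos n k) (A : Fin n → Cell k) : Prop :=
  (∀ x, (A x).Fits (p x)) ∧ count Cell.IsSeg A + outerCount p = n + 1

/-- The positions of the orientation faces of the cubie in position `p`. -/
abbrev OFace {n k : ℕ} (p : Pos n k) : Type :=
  {A : Fin n → Cell k // IsOrientationFace p A}

/-- The rule of a turn in the plane of the coordinates `i, j`: `A'ᵢ` is the opposite of `Aⱼ`,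
`A'ⱼ = Aᵢ`, and the other factors stay. -/
def rot {n : ℕ} {α : Type} (opp : α → α) (i j : Fin n) (A : Fin n → α) : Fin n → α :=
  fun x => if x = i then opp (A j) else if x = j then A i else A x

theorem rot_rot {n : ℕ} {α : Type} {opp : α → α} (h : Function.Involutive opp) {i j : Fin n}
    (hij : i ≠ j) (A : Fin n → α) : rot opp j i (rot opp i j A) = A := by
  funext x
  unfold rot
  split_ifs <;> simp_all [h _]

/-- `rot` as a permutation. -/
def rotEquiv {n : ℕ} {α : Type} (opp : α → α) (h : Function.Involutive opp) (i j : Fin n)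
    (hij : i ≠ j) : Equiv.Perm (Fin n → α) where
  toFun := rot opp i j
  invFun := rot opp j i
  left_inv := rot_rot h hij
  right_inv := rot_rot h hij.symm

theorem count_rot {n : ℕ} {α : Type} {opp : α → α} {P : α → Prop} (hP : ∀ a, P (opp a) ↔ P a)
    {i j : Fin n} (hij : i ≠ j) (A : Fin n → α) : count P (rot opp i j A) = count P A := by
  unfold count
  refine Finset.card_equiv (Equiv.swap i j) fun x => ?_
  simp only [Finset.mem_filter, Finset.mem_univ, true_and]
  unfold rot
  by_cases h1 : x = i
  · subst h1; simp [hP]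
  · by_cases h2 : x = j
    · subst h2; simp [h1]
    · simp [h1, h2, Equiv.swap_apply_of_ne_of_ne]

theorem Cell.opp_opp {k : ℕ} : Function.Involutive (Cell.opp (k := k)) := by
  intro c; cases c <;> simp [Cell.opp]

theorem Cell.isSeg_opp {k : ℕ} (c : Cell k) : c.opp.IsSeg ↔ c.IsSeg := by
  cases c <;> simp [Cell.opp, Cell.IsSeg]

theorem isOuter_rev {k : ℕ} (a : Fin k) : IsOuter a.rev ↔ IsOuter a := by
  have := a.isLt
  simp only [IsOuter, Fin.val_rev]
  omega

theorem Cell.fits_opp {k : ℕ} (a : Fin k) (c : Cell k) : c.opp.Fits a.rev ↔ c.Fits a := by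
  have := a.isLt
  cases c <;> simp only [Cell.opp, Cell.Fits, Fin.val_rev, Fin.rev_inj] <;> omega

theorem fits_rot {n k : ℕ} {i j : Fin n} {p : Pos n k} {A : Fin n → Cell k}
    (h : ∀ x, (A x).Fits (p x)) :
    ∀ x, (rot Cell.opp i j A x).Fits (rot Fin.rev i j p x) := by
  intro x
  unfold rot
  split_ifs
  · exact (Cell.fits_opp _ _).2 (h j)
  · exact h i
  · exact h x

theorem isOrientationFace_rot {n k : ℕ} {i j : Fin n} (hij : i ≠ j) (p : Pos n k)
    (A : Fin n → Cell k) :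
    IsOrientationFace p A ↔ IsOrientationFace (rot Fin.rev i j p) (rot Cell.opp i j A) := by
  unfold IsOrientationFace outerCount
  rw [count_rot isOuter_rev hij, count_rot Cell.isSeg_opp hij]
  refine and_congr_left fun _ => ⟨fits_rot, fun h => ?_⟩
  have := fits_rot (i := j) (j := i) h
  rwa [rot_rot Cell.opp_opp hij, rot_rot Fin.rev_rev hij] at this

/-- A turn of a layer: the layer consists of the cubies whose coordinates outside `free` have the
prescribed values (it is a `t`-dimensional layer, `t = free.card`), and it is turned in the plane
of the two coordinates `i`, `j` that are free in it. -/
structure Turn (n k : ℕ) where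
  free : Finset (Fin n)
  value : Fin n → Fin k
  i : Fin n
  j : Fin n
  ne : i ≠ j
  i_mem : i ∈ free
  j_mem : j ∈ free

namespace Turn

variable {n k : ℕ} (τ : Turn n k)

/-- The cubie in position `p` belongs to the layer. -/
def InLayer (p : Pos n k) : Prop := ∀ x, x ∉ τ.free → p x = τ.value x

/-- The turn in the opposite direction. -/
def symm : Turn n k := ⟨τ.free, τ.value, τ.j, τ.i, τ.ne.symm, τ.j_mem, τ.i_mem⟩

open Classical in
/-- The effect of the turn on positions of cubies. -/
noncomputable def move (p : Pos n k) : Pos n k :=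
  if τ.InLayer p then rot Fin.rev τ.i τ.j p else p

theorem inLayer_rot {p : Pos n k} (h : τ.InLayer p) :
    τ.InLayer (rot Fin.rev τ.i τ.j p) := by
  intro x hx
  have h1 : x ≠ τ.i := fun e => hx (e ▸ τ.i_mem)
  have h2 : x ≠ τ.j := fun e => hx (e ▸ τ.j_mem)
  simpa [rot, h1, h2] using h x hx

theorem symm_move (p : Pos n k) : τ.symm.move (τ.move p) = p := by
  by_cases h : τ.InLayer p
  · have h' : τ.symm.InLayer (rot Fin.rev τ.i τ.j p) := τ.inLayer_rot h
    unfold move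
    rw [if_pos h, if_pos h']
    exact rot_rot Fin.rev_rev τ.ne p
  · have h' : ¬ τ.symm.InLayer p := h
    unfold move
    rw [if_neg h, if_neg h']

/-- `move` as a permutation of the positions. -/
noncomputable def moveEquiv : Equiv.Perm (Pos n k) where
  toFun := τ.move
  invFun := τ.symm.move
  left_inv := τ.symm_move
  right_inv := τ.symm.symm_move

theorem outerCount_move (p : Pos n k) : outerCount (τ.move p) = outerCount p := by
  unfold move
  split_ifs
  · exact count_rot isOuter_rev τ.ne p
  · rfl

/-- The effect of the turn on the positions of the trivial class `(m)`. -/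
noncomputable def moveClass (m : ℕ) : Equiv.Perm (TrivClass n k m) :=
  τ.moveEquiv.subtypeEquiv fun p => by
    change outerCount p = m ↔ outerCount (τ.move p) = m
    rw [outerCount_move]

open Classical in
/-- The effect of the turn on the words of faces of a cubie in position `p`: a face moves together
with its cubie. -/
noncomputable def moveWord (p : Pos n k) : Equiv.Perm (Fin n → Cell k) :=
  if τ.InLayer p then rotEquiv Cell.opp Cell.opp_opp τ.i τ.j τ.ne else Equiv.refl _

theorem isOrientationFace_move (p : Pos n k) (A : Fin n → Cell k) :
    IsOrientationFace p A ↔ IsOrientationFace (τ.move p) (τ.moveWord p A) := by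
  unfold move moveWord
  split_ifs
  · exact isOrientationFace_rot τ.ne p A
  · rfl

/-- The effect of the turn on the orientation faces of the cubie in position `p`. -/
noncomputable def moveFace (p : Pos n k) : OFace p ≃ OFace (τ.move p) :=
  (τ.moveWord p).subtypeEquiv (τ.isOrientationFace_move p)

end Turn

/-- A state of the puzzle with numbered orientation faces.  The cubies of the trivial class `(m)`
are named by the elements of `TrivClass n k m`, and the `m` orientation faces of each of them are
numbered by `Fin m`.  `place m c` is the position of the cubie `c`, and `face m c s` is the
position of its face number `s`. -/
structure State (n k : ℕ) where
  place : ∀ m, Equiv.Perm (TrivClass n k m)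
  face : ∀ m (c : TrivClass n k m), Fin m ≃ OFace (place m c).1

/-- The state after a turn. -/
noncomputable def State.turn {n k : ℕ} (S : State n k) (τ : Turn n k) : State n k where
  place m := (S.place m).trans (τ.moveClass m)
  face m c := (S.face m c).trans (τ.moveFace (S.place m c).1)

/-- A combination is a sequence of turns, performed from the first to the last. -/
abbrev Combination (n k : ℕ) : Type := List (Turn n k)

/-- The state after a combination. -/
noncomputable def State.perform {n k : ℕ} (S : State n k) (w : Combination n k) : State n k :=
  w.foldl State.turn S

variable {n k : ℕ}

/-- The combination `w` preserves the position of the cubie `c`. -/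
def FixesPlace (S : State n k) (w : Combination n k) {m : ℕ} (c : TrivClass n k m) : Prop :=
  (S.perform w).place m c = S.place m c

/-- The combination `w` preserves the state of the cubie `c`: its position and the positions of
all of its orientation faces. -/
def FixesState (S : State n k) (w : Combination n k) {m : ℕ} (c : TrivClass n k m) : Prop :=
  FixesPlace S w c ∧ ∀ s, ((S.perform w).face m c s).1 = (S.face m c s).1

/-- The combination `w` is a careful orientation combination for the set `X` of cubies of the
trivial class `(m)`: it keeps the positions of all cubies of `X`, and the states of all other
cubies of the puzzle. -/
def IsCarefulOrientation (S : State n k) (w : Combination n k) {m : ℕ}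
    (X : Set (TrivClass n k m)) : Prop :=
  (∀ c ∈ X, FixesPlace S w c) ∧
    ∀ (m' : ℕ) (c : TrivClass n k m'), ¬ (∃ x ∈ X, x.1 = c.1) → FixesState S w c

/-- Two cubies belong to one class: some combination takes the first one from its position to the
position of the second one. -/
def SameClass (S : State n k) {m : ℕ} (a b : TrivClass n k m) : Prop :=
  ∃ w : Combination n k, (S.perform w).place m a = S.place m b

/-- The dependent rotation group of the cubie `c`, as a group of permutations of the numbers of its
orientation faces: it is generated by the permutations effected by the combinations that preserve
the position of `c`, where `σ` is effected if each face number `s` goes to the position that was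
occupied by the face number `σ s`. -/
def dependentGroup (S : State n k) {m : ℕ} (c : TrivClass n k m) :
    Subgroup (Equiv.Perm (Fin m)) :=
  Subgroup.closure {σ | ∃ w : Combination n k, FixesPlace S w c ∧
    ∀ s, ((S.perform w).face m c s).1 = (S.face m c (σ s)).1}

/-- A choice of the correct orientations: for every position, where the numbered orientation faces
of a cubie in it should be. -/
abbrev CorrectOrientation (n k : ℕ) : Type :=
  ∀ (m : ℕ) (p : TrivClass n k m), Fin m ≃ OFace p.1

/-- The orientation permutation `φ` of the cubie `c`: `φ s` is the number of the face that is now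
where the face number `s` should be. -/
def orientationPerm (R : CorrectOrientation n k) (S : State n k) {m : ℕ}
    (c : TrivClass n k m) : Equiv.Perm (Fin m) :=
  (R m (S.place m c)).trans (S.face m c).symm

end Rubik

namespace Rubik

variable {n k : ℕ}

/-! An orientation face is determined by the one outer coordinate in which it is still a segment.
The puzzle thus becomes a group acting on pairs (position, coordinate): an element carries `p` to
some `q` together with a permutation of the coordinates, and orientation sees only the outer ones.

Let `g` preserve the position `p`, let `h` carry `p` to `q ≠ p`, and let every other cubie be
untouched by `g` or by `h`. Then `g h g⁻¹ h⁻¹` rotates `p` as `g` does, compensates at `q`, and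
changes nothing else (`mem_realizable_of_disjoint`). Explicit elements that rotate `p` and fix the
rest of a face through it give all 3-cycles of outer coordinates, hence all even rotations
(`mem_realizable_of_even`). By a parity invariant, an odd rotation requires a middle factor or two
inner factors that agree up to reflection (`exists_inner_of_odd`). In either case a turn exchanging
an outer factor with an inner one admits a careful transposition (`exists_odd_mem_realizable`). The
remaining turns either decompose into such turns or meet no odd rotation, and `Related.trans` chains
turns along a combination. This gives part 1.

For part 2, a cubie with a non-trivial rotation has two distinct reflected positions `q`, `r` in its
class. The commutator of an element careful for `{p, q}` with one careful for `{p, r}` changes only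
`p`. -/

/-! ### Facelets: a face of a cubie is recorded by a coordinate -/

/-- A position together with a coordinate, which stands for a face of the cubie there. -/
abbrev Facelet (n k : ℕ) : Type := Pos n k × Fin n

/-- The element `g` takes the cubie in position `p` to the position `q`, and permutes its
coordinates by `π`. -/
def Sends (g : Equiv.Perm (Facelet n k)) (p q : Pos n k) (π : Equiv.Perm (Fin n)) : Prop :=
  ∀ x, g (p, x) = (q, π x)

namespace Sends

variable {g h : Equiv.Perm (Facelet n k)} {p q r : Pos n k} {π ρ : Equiv.Perm (Fin n)}

theorem one (p : Pos n k) : Sends 1 p p 1 := fun _ => rfl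

theorem mul (hg : Sends g q r ρ) (hh : Sends h p q π) : Sends (g * h) p r (ρ * π) := by
  intro x
  rw [Equiv.Perm.mul_apply, hh x, hg (π x)]
  rfl

theorem inv (hg : Sends g p q π) : Sends g⁻¹ q p π⁻¹ := by
  intro x
  rw [Equiv.Perm.inv_eq_iff_eq, hg]
  simp

theorem unique_pos [NeZero n] (h₁ : Sends g p q π) (h₂ : Sends g p r ρ) : q = r :=
  congrArg Prod.fst ((h₁ 0).symm.trans (h₂ 0))

theorem unique_perm (h₁ : Sends g p q π) (h₂ : Sends g p r ρ) : π = ρ :=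
  Equiv.ext fun x => congrArg Prod.snd ((h₁ x).symm.trans (h₂ x))

theorem inj [NeZero n] (h₁ : Sends g p r π) (h₂ : Sends g q r ρ) : p = q :=
  h₁.inv.unique_pos h₂.inv

end Sends

open Classical in
/-- The effect of a turn on facelets. -/
noncomputable def facePerm (τ : Turn n k) : Equiv.Perm (Facelet n k) where
  toFun f := (τ.move f.1, if τ.InLayer f.1 then Equiv.swap τ.i τ.j f.2 else f.2)
  invFun f := (τ.symm.move f.1, if τ.InLayer f.1 then Equiv.swap τ.i τ.j f.2 else f.2)
  left_inv := by
    rintro ⟨p, x⟩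
    by_cases h : τ.InLayer p
    · have h' := τ.inLayer_rot h
      simp [h, Turn.move, h']
      simpa [Turn.move, h] using τ.symm_move p
    · simpa [h, Turn.move] using τ.symm_move p
  right_inv := by
    rintro ⟨p, x⟩
    have key : τ.move (τ.symm.move p) = p := τ.symm.symm_move p
    by_cases h : τ.InLayer p
    · have h' : τ.InLayer (τ.symm.move p) := by
        have : τ.symm.InLayer p := h
        rw [Turn.move, if_pos this]
        exact τ.symm.inLayer_rot h
      simp [key, h, h']
    · have h' : τ.symm.move p = p := by
        have : ¬ τ.symm.InLayer p := h
        rw [Turn.move, if_neg this]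
      simp [h, h'] at key ⊢
      exact key

theorem facePerm_sends_of_inLayer {τ : Turn n k} {p : Pos n k} (h : τ.InLayer p) :
    Sends (facePerm τ) p (rot Fin.rev τ.i τ.j p) (Equiv.swap τ.i τ.j) := by
  intro x
  simp [facePerm, h, Turn.move]

theorem facePerm_sends_of_not_inLayer {τ : Turn n k} {p : Pos n k} (h : ¬ τ.InLayer p) :
    Sends (facePerm τ) p p 1 := by
  intro x
  simp [facePerm, h, Turn.move]

theorem facePerm_symm (τ : Turn n k) : facePerm τ.symm = (facePerm τ)⁻¹ := by
  refine eq_inv_of_mul_eq_one_left (Equiv.ext fun ⟨p, x⟩ => ?_)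
  by_cases h : τ.InLayer p
  · have h' : τ.symm.InLayer (rot Fin.rev τ.i τ.j p) := τ.inLayer_rot h
    rw [((facePerm_sends_of_inLayer h').mul (facePerm_sends_of_inLayer h)) x]
    change (rot Fin.rev τ.j τ.i (rot Fin.rev τ.i τ.j p), (Equiv.swap τ.j τ.i * Equiv.swap τ.i τ.j) x) = _
    rw [rot_rot Fin.rev_rev τ.ne, Equiv.swap_comm]
    simp
  · have h' : ¬ τ.symm.InLayer p := h
    rw [((facePerm_sends_of_not_inLayer h').mul (facePerm_sends_of_not_inLayer h)) x]
    rfl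

/-! ### Words and the group generated by the turns -/

/-- The group generated by the turns. -/
def turnGroup (n k : ℕ) : Subgroup (Equiv.Perm (Facelet n k)) :=
  Subgroup.closure (Set.range facePerm)

/-- The effect of a combination on facelets. -/
noncomputable def wordPerm : Combination n k → Equiv.Perm (Facelet n k)
  | [] => 1
  | τ :: w => wordPerm w * facePerm τ

theorem wordPerm_append (v w : Combination n k) :
    wordPerm (v ++ w) = wordPerm w * wordPerm v := by
  induction v with
  | nil => rfl
  | cons τ v ih => simp only [List.cons_append, wordPerm, ih, mul_assoc]

theorem facePerm_mem (τ : Turn n k) : facePerm τ ∈ turnGroup n k :=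
  Subgroup.subset_closure ⟨τ, rfl⟩

theorem wordPerm_mem (w : Combination n k) : wordPerm w ∈ turnGroup n k := by
  induction w with
  | nil => exact one_mem _
  | cons τ w ih => exact mul_mem ih (facePerm_mem τ)

theorem exists_wordPerm_inv (w : Combination n k) : ∃ v, wordPerm v = (wordPerm w)⁻¹ := by
  induction w with
  | nil => exact ⟨[], by simp [wordPerm]⟩
  | cons τ w ih =>
    obtain ⟨v, hv⟩ := ih
    refine ⟨v ++ [τ.symm], ?_⟩
    rw [wordPerm_append, hv]
    simp [wordPerm, facePerm_symm]

theorem exists_wordPerm {g : Equiv.Perm (Facelet n k)} (hg : g ∈ turnGroup n k) :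
    ∃ w, wordPerm w = g := by
  induction hg using Subgroup.closure_induction with
  | mem g hg =>
    obtain ⟨τ, rfl⟩ := hg
    exact ⟨[τ], by simp [wordPerm]⟩
  | one => exact ⟨[], rfl⟩
  | mul g h _ _ ihg ihh =>
    obtain ⟨v, rfl⟩ := ihg
    obtain ⟨w, rfl⟩ := ihh
    exact ⟨w ++ v, wordPerm_append w v⟩
  | inv g _ ih =>
    obtain ⟨v, rfl⟩ := ih
    exact exists_wordPerm_inv v

theorem rot_apply_swap {α : Type} (opp : α → α) {i j : Fin n} (hij : i ≠ j) (A : Fin n → α)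
    (x : Fin n) : rot opp i j A (Equiv.swap i j x) = if x = j then opp (A x) else A x := by
  unfold rot
  by_cases h1 : x = i
  · subst h1; simp [hij, hij.symm]
  · by_cases h2 : x = j
    · subst h2; simp
    · simp [Equiv.swap_apply_of_ne_of_ne h1 h2, h1, h2]

/-! ### Invariants of the turn group -/

/-- Two segments that agree up to the reflection of `[0, k]`. -/
def SameAbs (a b : Fin k) : Prop := a = b ∨ a = b.rev

theorem SameAbs.refl (a : Fin k) : SameAbs a a := Or.inl rfl

theorem SameAbs.symm {a b : Fin k} (h : SameAbs a b) : SameAbs b a := by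
  rcases h with h | h
  · exact Or.inl h.symm
  · exact Or.inr (by rw [h, Fin.rev_rev])

theorem SameAbs.trans {a b c : Fin k} (h : SameAbs a b) (h' : SameAbs b c) : SameAbs a c := by
  rcases h with rfl | rfl <;> rcases h' with rfl | rfl <;> simp [SameAbs]

theorem SameAbs.isOuter_iff {a b : Fin k} (h : SameAbs a b) : IsOuter a ↔ IsOuter b := by
  rcases h with rfl | rfl
  · rfl
  · exact isOuter_rev b

theorem sameAbs_of_isOuter {a b : Fin k} (ha : IsOuter a) (hb : IsOuter b) : SameAbs a b := by
  have := a.isLt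
  have := b.isLt
  unfold IsOuter at ha hb
  unfold SameAbs
  rw [Fin.ext_iff, Fin.ext_iff, Fin.val_rev]
  omega

/-- The sign of a segment: whether it lies in the left half of `[0, k]`. -/
def segSign (a : Fin k) : ℤˣ := if a < a.rev then 1 else -1

theorem segSign_rev {a : Fin k} (h : a.rev ≠ a) : segSign a.rev = - segSign a := by
  unfold segSign
  rw [Fin.rev_rev]
  rcases lt_or_gt_of_ne h with h | h
  · simp [h, not_lt.2 h.le]
  · simp [h, not_lt.2 h.le]

/-- A turn transposes two coordinates and reflects one factor. So factors travel unchanged up to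
reflection, and the two sign changes cancel, provided that no factor is the middle segment, whose
sign a reflection does not change. -/
theorem exists_sends {g : Equiv.Perm (Facelet n k)} (hg : g ∈ turnGroup n k) (p : Pos n k) :
    ∃ q π, Sends g p q π ∧ (∀ x, SameAbs (q (π x)) (p x)) ∧
      ((∀ x, (p x).rev ≠ p x) → Equiv.Perm.sign π * ∏ x, segSign (q x) = ∏ x, segSign (p x)) := by
  obtain ⟨w, rfl⟩ := exists_wordPerm hg
  clear hg
  induction w generalizing p with
  | nil => exact ⟨p, 1, Sends.one p, fun x => SameAbs.refl _, by simp⟩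
  | cons τ w ih =>
    by_cases h : τ.InLayer p
    · obtain ⟨q, π, h1, h2, h3⟩ := ih (rot Fin.rev τ.i τ.j p)
      have key : ∀ x, SameAbs (rot Fin.rev τ.i τ.j p (Equiv.swap τ.i τ.j x)) (p x) := by
        intro x
        rw [rot_apply_swap _ τ.ne]
        split_ifs
        · exact Or.inr rfl
        · exact Or.inl rfl
      refine ⟨q, _, h1.mul (facePerm_sends_of_inLayer h), fun x => (h2 _).trans (key x), ?_⟩
      intro hp
      rw [map_mul, Equiv.Perm.sign_swap τ.ne, mul_neg_one, neg_mul, h3,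
        ← Equiv.prod_comp (Equiv.swap τ.i τ.j)]
      · simp only [rot_apply_swap _ τ.ne]
        rw [← Finset.mul_prod_erase _ _ (Finset.mem_univ τ.j),
          ← Finset.mul_prod_erase _ (fun x => segSign (p x)) (Finset.mem_univ τ.j), if_pos rfl,
          segSign_rev (hp _), neg_mul, neg_neg]
        congr 1
        exact Finset.prod_congr rfl fun x hx => by rw [if_neg (Finset.ne_of_mem_erase hx)]
      · intro x
        unfold rot
        split_ifs
        · rw [Fin.rev_rev]
          exact (hp _).symm
        · exact hp _
        · exact hp _
    · obtain ⟨q, π, h1, h2, h3⟩ := ih p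
      exact ⟨q, π, h1.mul (facePerm_sends_of_not_inLayer h), h2, h3⟩

theorem Sends.sameAbs [NeZero n] {g : Equiv.Perm (Facelet n k)} (hg : g ∈ turnGroup n k)
    {p q : Pos n k} {π : Equiv.Perm (Fin n)} (h : Sends g p q π) (x : Fin n) :
    SameAbs (q (π x)) (p x) := by
  obtain ⟨q', π', h1, h2, -⟩ := exists_sends hg p
  obtain rfl := h.unique_pos h1
  obtain rfl := h.unique_perm h1
  exact h2 x

theorem Sends.sign_eq_one [NeZero n] {g : Equiv.Perm (Facelet n k)} (hg : g ∈ turnGroup n k)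
    {p : Pos n k} {π : Equiv.Perm (Fin n)} (h : Sends g p p π) (hp : ∀ x, (p x).rev ≠ p x) :
    Equiv.Perm.sign π = 1 := by
  obtain ⟨q', π', h1, -, h2⟩ := exists_sends hg p
  obtain rfl := h.unique_pos h1
  obtain rfl := h.unique_perm h1
  exact mul_eq_right.1 (h2 hp)

theorem Sends.isOuter_iff [NeZero n] {g : Equiv.Perm (Facelet n k)} (hg : g ∈ turnGroup n k)
    {p q : Pos n k} {π : Equiv.Perm (Fin n)} (h : Sends g p q π) (x : Fin n) :
    IsOuter (q (π x)) ↔ IsOuter (p x) :=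
  (h.sameAbs hg x).isOuter_iff

/-! ### Effects on the orientation of one cubie -/

/-- The outer coordinates of a position; they correspond to the orientation faces there. -/
abbrev Outer (p : Pos n k) : Type := {x : Fin n // IsOuter (p x)}

/-- The element `g` preserves the position `p` and permutes the orientation faces there by `σ`. -/
def HasEffect (g : Equiv.Perm (Facelet n k)) (p : Pos n k) (σ : Equiv.Perm (Outer p)) : Prop :=
  ∃ π, Sends g p p π ∧ ∀ x : Outer p, π x = σ x

namespace HasEffect

variable {g h : Equiv.Perm (Facelet n k)} {p : Pos n k} {σ τ : Equiv.Perm (Outer p)}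

theorem one (p : Pos n k) : HasEffect 1 p 1 := ⟨1, Sends.one p, fun _ => rfl⟩

theorem mul (hg : HasEffect g p σ) (hh : HasEffect h p τ) : HasEffect (g * h) p (σ * τ) := by
  obtain ⟨π, h1, h2⟩ := hg
  obtain ⟨ρ, h3, h4⟩ := hh
  exact ⟨π * ρ, h1.mul h3, fun x => by
    rw [Equiv.Perm.mul_apply, h4, h2, Equiv.Perm.mul_apply]⟩

theorem inv (hg : HasEffect g p σ) : HasEffect g⁻¹ p σ⁻¹ := by
  obtain ⟨π, h1, h2⟩ := hg
  refine ⟨π⁻¹, h1.inv, fun x => ?_⟩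
  rw [Equiv.Perm.inv_eq_iff_eq, h2]
  simp

theorem unique (h₁ : HasEffect g p σ) (h₂ : HasEffect g p τ) : σ = τ := by
  obtain ⟨π, h1, h2⟩ := h₁
  obtain ⟨ρ, h3, h4⟩ := h₂
  obtain rfl := h1.unique_perm h3
  exact Equiv.ext fun x => Subtype.ext ((h2 x).symm.trans (h4 x))

end HasEffect

theorem Sends.hasEffect_one {g : Equiv.Perm (Facelet n k)} {p : Pos n k} (h : Sends g p p 1) :
    HasEffect g p 1 := ⟨1, h, fun _ => rfl⟩

theorem Sends.hasEffect [NeZero n] {g : Equiv.Perm (Facelet n k)} (hg : g ∈ turnGroup n k)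
    {p : Pos n k} {π : Equiv.Perm (Fin n)} (h : Sends g p p π) :
    HasEffect g p (π.subtypePerm fun x => h.isOuter_iff hg x) := ⟨π, h, fun _ => rfl⟩

/-! ### Careful elements and commutators -/

/-- The element `g` of the group preserves the positions in `X`, and the states of the cubies in
all other positions. -/
structure Careful (g : Equiv.Perm (Facelet n k)) (X : Set (Pos n k)) : Prop where
  mem : g ∈ turnGroup n k
  fixes : ∀ p ∈ X, ∃ σ, HasEffect g p σ
  trivial : ∀ p ∉ X, HasEffect g p 1

namespace Careful

variable {g h : Equiv.Perm (Facelet n k)} {X Y : Set (Pos n k)}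

theorem one (X : Set (Pos n k)) : Careful 1 X :=
  ⟨one_mem _, fun p _ => ⟨1, HasEffect.one p⟩, fun p _ => HasEffect.one p⟩

theorem mul (hg : Careful g X) (hh : Careful h X) : Careful (g * h) X where
  mem := mul_mem hg.mem hh.mem
  fixes p hp := by
    obtain ⟨σ, hσ⟩ := hg.fixes p hp
    obtain ⟨τ, hτ⟩ := hh.fixes p hp
    exact ⟨_, hσ.mul hτ⟩
  trivial p hp := by simpa using (hg.trivial p hp).mul (hh.trivial p hp)

theorem inv (hg : Careful g X) : Careful g⁻¹ X where
  mem := inv_mem hg.mem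
  fixes p hp := by
    obtain ⟨σ, hσ⟩ := hg.fixes p hp
    exact ⟨_, hσ.inv⟩
  trivial p hp := by simpa using (hg.trivial p hp).inv

theorem exists_effect (hg : Careful g X) (p : Pos n k) : ∃ σ, HasEffect g p σ := by
  by_cases hp : p ∈ X
  · exact hg.fixes p hp
  · exact ⟨1, hg.trivial p hp⟩

end Careful

/-- The permutations of the orientation faces in position `p` that are effected by careful
elements. -/
def realizable (X : Set (Pos n k)) (p : Pos n k) : Subgroup (Equiv.Perm (Outer p)) where
  carrier := {σ | ∃ g, Careful g X ∧ HasEffect g p σ}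
  one_mem' := ⟨1, Careful.one X, HasEffect.one p⟩
  mul_mem' := by
    rintro σ τ ⟨g, hg, hσ⟩ ⟨h, hh, hτ⟩
    exact ⟨g * h, hg.mul hh, hσ.mul hτ⟩
  inv_mem' := by
    rintro σ ⟨g, hg, hσ⟩
    exact ⟨g⁻¹, hg.inv, hσ.inv⟩

/-- Every rotation of the cubie in position `p` is effected by an element that is careful outside
`{p, q}`. -/
def Related (p q : Pos n k) : Prop :=
  ∀ g ∈ turnGroup n k, ∀ σ, HasEffect g p σ → σ ∈ realizable {p, q} p

/-- An element careful for `{p, q}` leaves an unwanted rotation at `q`. Its inverse is effected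
there by an element careful for `{q, r}`, which shifts the debt to `r` without touching `p`. -/
theorem Related.trans {p q r : Pos n k} (hpq : Related p q) (hqr : Related q r) (h₁ : p ≠ q)
    (h₂ : p ≠ r) : Related p r := by
  intro u hu σ hσ
  obtain ⟨e, he, heσ⟩ := hpq u hu σ hσ
  obtain ⟨τ, hτ⟩ := he.exists_effect q
  obtain ⟨f, hf, hfτ⟩ := hqr e⁻¹ (inv_mem he.mem) τ⁻¹ hτ.inv
  refine ⟨f * e, ⟨mul_mem hf.mem he.mem, fun s _ => ?_, fun s hs => ?_⟩, ?_⟩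
  · obtain ⟨a, ha⟩ := he.exists_effect s
    obtain ⟨b, hb⟩ := hf.exists_effect s
    exact ⟨_, hb.mul ha⟩
  · by_cases hsq : s = q
    · subst hsq
      simpa using hfτ.mul hτ
    · simp only [Set.mem_insert_iff, Set.mem_singleton_iff, not_or] at hs
      simpa using (hf.trivial s (by simp [hsq, hs.2])).mul (he.trivial s (by simp [hsq, hs.1]))
  · simpa using (hf.trivial p (by simp [h₁, h₂])).mul heσ

theorem eq_or_related_trans {p q r : Pos n k} (hpq : p = q ∨ Related p q)
    (hqr : q = r ∨ Related q r) : p = r ∨ Related p r := by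
  by_cases h₂ : p = r
  · exact Or.inl h₂
  by_cases h₁ : p = q
  · exact h₁ ▸ hqr
  by_cases h₃ : q = r
  · exact h₃ ▸ hpq
  exact Or.inr ((hpq.resolve_left h₁).trans (hqr.resolve_left h₃) h₁ h₂)

/-- A commutator of two elements that have only the cubie in position `p` in common. -/
theorem mem_realizable_of_disjoint [NeZero n] {g h : Equiv.Perm (Facelet n k)}
    (hg : g ∈ turnGroup n k) (hh : h ∈ turnGroup n k) {p q : Pos n k} {π ρ : Equiv.Perm (Fin n)}
    (hgp : Sends g p p π) (hhp : Sends h p q ρ) (hpq : p ≠ q)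
    (hd : ∀ r, r ≠ p → Sends g r r 1 ∨ Sends h r r 1) {σ : Equiv.Perm (Outer p)}
    (hσ : ∀ x : Outer p, π x = σ x) : σ ∈ realizable {p, q} p := by
  have not_triv : ∀ {r s ρ'}, Sends h r s ρ' → r ≠ s → ¬ Sends h r r 1 := fun h1 h2 h3 =>
    h2 (h3.unique_pos h1)
  have hgq : Sends g q q 1 := (hd q hpq.symm).resolve_right fun h1 =>
    hpq (hhp.inj h1)
  obtain ⟨s, ρ', hs, -⟩ := exists_sends (inv_mem hh) p
  have hs' : Sends h s p ρ'⁻¹ := by simpa using hs.inv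
  have hsp : s ≠ p := by
    rintro rfl
    exact hpq (hs'.unique_pos hhp)
  have hgs : Sends g s s 1 := (hd s hsp).resolve_right (not_triv hs' hsp)
  -- At `p` the conjugate is trivial: `h⁻¹` leads to a position `s ≠ p` that `h` moves, so `g` fixes
  -- it. At `q` the conjugate leaves the inverse of the rotation at `p`, carried over by `h`.
  refine ⟨g * (h * g⁻¹ * h⁻¹), ⟨mul_mem hg (mul_mem (mul_mem hh (inv_mem hg)) (inv_mem hh)), ?_, ?_⟩,
    ?_⟩
  · rintro r (rfl | rfl)
    · exact ⟨_, (hgp.mul ((hs'.mul hgs.inv).mul hs)).hasEffect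
        (mul_mem hg (mul_mem (mul_mem hh (inv_mem hg)) (inv_mem hh)))⟩
    · exact ⟨_, (hgq.mul ((hhp.mul hgp.inv).mul hhp.inv)).hasEffect
        (mul_mem hg (mul_mem (mul_mem hh (inv_mem hg)) (inv_mem hh)))⟩
  · intro r hr
    simp only [Set.mem_insert_iff, Set.mem_singleton_iff, not_or] at hr
    apply Sends.hasEffect_one
    obtain ⟨t, ρ₁, ht, -⟩ := exists_sends (inv_mem hh) r
    have ht' : Sends h t r ρ₁⁻¹ := by simpa using ht.inv
    obtain ⟨v, π₁, hv, -⟩ := exists_sends (inv_mem hg) r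
    have hv' : Sends g v r π₁⁻¹ := by simpa using hv.inv
    -- If `h` is trivial at `r`, then either `g⁻¹` keeps `r` in place or `h` is also trivial at the
    -- position to which `g⁻¹` leads. If not, `g` is trivial both at `r` and at its preimage under
    -- `h`.
    by_cases hr1 : Sends h r r 1
    · by_cases hvr : v = r
      · subst hvr
        simpa using hv'.mul ((hr1.mul hv).mul hr1.inv)
      · have hvp : v ≠ p := by
          rintro rfl
          exact hr.1 (hv'.unique_pos hgp)
        have hv1 : Sends h v v 1 := (hd v hvp).resolve_left fun h1 => hvr (h1.unique_pos hv')
        simpa using hv'.mul ((hv1.mul hv).mul hr1.inv)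
    · have hgr : Sends g r r 1 := (hd r hr.1).resolve_right hr1
      have htp : t ≠ p := by
        rintro rfl
        exact hr.2 (ht'.unique_pos hhp)
      have hgt : Sends g t t 1 := (hd t htp).resolve_right fun h1 => by
        obtain rfl := h1.unique_pos ht'
        exact hr1 h1
      simpa using hgr.mul ((ht'.mul hgt.inv).mul ht)
  · have := hgp.mul ((hs'.mul hgs.inv).mul hs)
    exact ⟨π, by simpa using this, hσ⟩

/-- Since `q ≠ r`, at every position other than `p` one of the two elements acts trivially on
orientation, which makes the commutator trivial there. -/
theorem mem_realizable_singleton_of_commutator [NeZero n] {p q r : Pos n k} (hqr : q ≠ r)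
    {σ τ : Equiv.Perm (Outer p)} (hσ : σ ∈ realizable {p, q} p)
    (hτ : τ ∈ realizable {p, r} p) : σ * τ * σ⁻¹ * τ⁻¹ ∈ realizable {p} p := by
  obtain ⟨g, hg, hgσ⟩ := hσ
  obtain ⟨h, hh, hhτ⟩ := hτ
  refine ⟨g * h * g⁻¹ * h⁻¹, ⟨?_, ?_, ?_⟩, ((hgσ.mul hhτ).mul hgσ.inv).mul hhτ.inv⟩
  · exact mul_mem (mul_mem (mul_mem hg.mem hh.mem) (inv_mem hg.mem)) (inv_mem hh.mem)
  · rintro s rfl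
    exact ⟨_, ((hgσ.mul hhτ).mul hgσ.inv).mul hhτ.inv⟩
  · intro s hs
    rw [Set.mem_singleton_iff] at hs
    obtain ⟨α, hα⟩ := hg.exists_effect s
    obtain ⟨β, hβ⟩ := hh.exists_effect s
    have key := ((hα.mul hβ).mul hα.inv).mul hβ.inv
    by_cases hsq : s = q
    · have h1 : β = 1 := hβ.unique (hh.trivial s (by simp [hsq, hqr]; exact hsq ▸ hs))
      simpa [h1] using key
    · have h1 : α = 1 := hα.unique (hg.trivial s (by simp [hs, hsq]))
      simpa [h1] using key

open Classical in
-- Otherwise the inner factors differ pairwise even up to reflection, so a rotation keeps every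
-- inner coordinate. Its sign on the outer coordinates is then its full sign, which the parity
-- invariant forces to be `1`.
theorem exists_inner_of_odd [NeZero n] {g : Equiv.Perm (Facelet n k)} (hg : g ∈ turnGroup n k)
    {p : Pos n k} {σ : Equiv.Perm (Outer p)} (h : HasEffect g p σ)
    (hσ : Equiv.Perm.sign σ = -1) :
    (∃ z, (p z).rev = p z) ∨ ∃ u w, u ≠ w ∧ ¬ IsOuter (p u) ∧ ¬ IsOuter (p w) ∧
      SameAbs (p u) (p w) := by
  by_contra! hcon
  obtain ⟨h1, h2⟩ := hcon
  obtain ⟨π, hπ, hπσ⟩ := h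
  have hiff := fun x => hπ.isOuter_iff hg x
  have key : π.subtypePerm hiff = σ := Equiv.ext fun x => Subtype.ext (hπσ x)
  have hsign := Equiv.Perm.sign_subtypePerm π hiff fun x hx => by
    by_contra hx'
    exact h2 (π x) x hx (fun h => hx' ((hiff x).1 h)) hx' (hπ.sameAbs hg x)
  rw [key, hσ, hπ.sign_eq_one hg h1] at hsign
  exact absurd hsign (by decide)

/-! ### Turns of two-dimensional layers -/

/-- The position `r` lies in the two-dimensional layer in the directions `i`, `j` through `p`. -/
def InSlice (i j : Fin n) (p r : Pos n k) : Prop := ∀ x, x ≠ i → x ≠ j → r x = p x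

theorem InSlice.refl (i j : Fin n) (p : Pos n k) : InSlice i j p p := fun _ _ _ => rfl

theorem InSlice.eq {i j : Fin n} {p r : Pos n k} (h : InSlice i j p r) (hi : r i = p i)
    (hj : r j = p j) : r = p := by
  funext x
  by_cases h1 : x = i
  · rw [h1, hi]
  by_cases h2 : x = j
  · rw [h2, hj]
  exact h x h1 h2

/-- The turn of the two-dimensional layer through `p` in its plane. -/
noncomputable def slice (i j : Fin n) (hij : i ≠ j) (p : Pos n k) : Equiv.Perm (Facelet n k) :=
  facePerm ⟨{i, j}, p, i, j, hij, by simp, by simp⟩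

section slice

variable {i j : Fin n} (hij : i ≠ j) {p r : Pos n k}

theorem slice_mem : slice i j hij p ∈ turnGroup n k := facePerm_mem _

theorem slice_sends (h : InSlice i j p r) :
    Sends (slice i j hij p) r (rot Fin.rev i j r) (Equiv.swap i j) :=
  facePerm_sends_of_inLayer (τ := ⟨{i, j}, p, i, j, hij, by simp, by simp⟩) fun x hx => by
    simp only [Finset.mem_insert, Finset.mem_singleton, not_or] at hx
    exact h x hx.1 hx.2

theorem slice_sends_of_not (h : ¬ InSlice i j p r) : Sends (slice i j hij p) r r 1 :=
  facePerm_sends_of_not_inLayer (τ := ⟨{i, j}, p, i, j, hij, by simp, by simp⟩) fun h' =>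
    h fun x h1 h2 => h' x (by simp [h1, h2])

end slice

/-- Reflection of one coordinate of a position. -/
def flip (i : Fin n) (p : Pos n k) : Pos n k := Function.update p i (p i).rev

@[simp] theorem flip_self (i : Fin n) (p : Pos n k) : flip i p i = (p i).rev := by simp [flip]

theorem flip_of_ne {i x : Fin n} (h : x ≠ i) (p : Pos n k) : flip i p x = p x := by
  simp [flip, h]

@[simp] theorem flip_flip (i : Fin n) (p : Pos n k) : flip i (flip i p) = p := by
  simp [flip]

theorem flip_comm (i j : Fin n) (p : Pos n k) : flip i (flip j p) = flip j (flip i p) := by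
  by_cases h : i = j
  · rw [h]
  · simp only [flip, Function.update_of_ne h, Function.update_of_ne (Ne.symm h)]
    exact Function.update_comm (Ne.symm h) _ _ _

theorem rot_rot_self {i j : Fin n} (hij : i ≠ j) (p : Pos n k) :
    rot Fin.rev i j (rot Fin.rev i j p) = flip i (flip j p) := by
  funext x
  simp only [flip, Function.update_apply, rot]
  split_ifs <;> simp_all

theorem inSlice_rot {i j : Fin n} {p r : Pos n k} (h : InSlice i j p r) :
    InSlice i j p (rot Fin.rev i j r) := fun x h1 h2 => by simpa [rot, h1, h2] using h x h1 h2

theorem InSlice.swap {i j : Fin n} {p r : Pos n k} (h : InSlice i j p r) : InSlice j i p r :=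
  fun x h1 h2 => h x h2 h1

theorem slice_mul_self_sends {i j : Fin n} (hij : i ≠ j) {p r : Pos n k} (h : InSlice i j p r) :
    Sends (slice i j hij p * slice i j hij p) r (flip i (flip j r)) 1 := by
  have := (slice_sends hij (inSlice_rot h)).mul (slice_sends hij h)
  rwa [rot_rot_self hij, Equiv.swap_mul_self] at this

theorem rot_eq_flip {i j : Fin n} {p : Pos n k} (h : p i = p j) :
    rot Fin.rev i j p = flip i p := by
  funext x
  simp only [flip, Function.update_apply, rot]
  split_ifs <;> simp_all

theorem rot_eq_flip' {i j : Fin n} (hij : i ≠ j) {p : Pos n k} (h : p i = (p j).rev) :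
    rot Fin.rev j i p = flip i p := by
  funext x
  simp only [flip, Function.update_apply, rot]
  split_ifs <;> simp_all

/-- One of the two turns of the layer in the directions `i`, `j` through `p` reflects the
coordinate `i` of `p`. -/
theorem exists_turn_flip {i j : Fin n} (hij : i ≠ j) {p : Pos n k} (h : SameAbs (p i) (p j)) :
    ∃ R ∈ turnGroup n k, Sends R p (flip i p) (Equiv.swap i j) ∧
      (∀ r, ¬ InSlice i j p r → Sends R r r 1) ∧
      (∀ r, InSlice i j p r → Sends (R * R) r (flip i (flip j r)) 1) ∧
      (∀ r, InSlice i j p r → ∃ s, Sends R r s (Equiv.swap i j) ∧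
        (s i = (p i).rev → r j = p j)) := by
  rcases h with h | h
  · refine ⟨slice i j hij p, slice_mem hij, ?_, fun r => slice_sends_of_not hij,
      fun r => slice_mul_self_sends hij, fun r hr => ⟨_, slice_sends hij hr, fun hs => ?_⟩⟩
    · rw [← rot_eq_flip h]
      exact slice_sends hij (InSlice.refl i j p)
    · simpa [rot, h] using hs
  · refine ⟨slice j i hij.symm p, slice_mem hij.symm, ?_,
      fun r hr => slice_sends_of_not hij.symm fun h => hr h.swap,
      fun r hr => ?_, fun r hr => ⟨rot Fin.rev j i r, ?_, fun hs => ?_⟩⟩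
    · rw [← rot_eq_flip' hij h, Equiv.swap_comm]
      exact slice_sends hij.symm (InSlice.refl j i p)
    · rw [flip_comm]
      exact slice_mul_self_sends hij.symm hr.swap
    · rw [Equiv.swap_comm]
      exact slice_sends hij.symm hr.swap
    · simpa [rot, h, hij] using hs

theorem IsOuter.rev_ne (hk : 2 ≤ k) {a : Fin k} (h : IsOuter a) : a.rev ≠ a := by
  have := a.isLt
  unfold IsOuter at h
  rw [ne_eq, Fin.ext_iff, Fin.val_rev]
  omega

/-! ### Elements that preserve one cubie of a face up to a rotation, and the rest of the face -/

/-- Half of the rotation of a corner: a conjugate of a half turn. -/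
theorem conj_half_turn_sends {a b : Fin n} (hk : 2 ≤ k) {p : Pos n k}
    (ha : IsOuter (p a)) {R D : Equiv.Perm (Facelet n k)}
    (hR : ∀ r, ¬ InSlice a b p r → Sends R r r 1)
    (hR' : ∀ r, InSlice a b p r → ∃ s, Sends R r s (Equiv.swap a b) ∧
        (s a = (p a).rev → r b = p b))
    (hD : ∀ r, r a ≠ (p a).rev → Sends D r r 1) {r : Pos n k} (hr : r a = p a) (hrp : r ≠ p) :
    Sends (R⁻¹ * D * R) r r 1 := by
  by_cases h : InSlice a b p r
  · obtain ⟨s, h1, h2⟩ := hR' r h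
    have h3 : Sends D s s 1 := hD s fun h' => hrp (h.eq hr (h2 h'))
    simpa using (h1.inv.mul h3).mul h1
  · have h3 : Sends D r r 1 := hD r (by rw [hr]; exact (ha.rev_ne hk).symm)
    simpa using ((hR r h).inv.mul h3).mul (hR r h)

/-- `R` and `F` reflect `p` in the direction `a`, by turns in the planes `a, b` and `a, c`; `D` is a
half turn in the plane `b, c` on the far side. The cubie goes out by `R`, is carried by `D` beyond
the slices of `R` and `F`, comes back by the second `D` and returns by `F⁻¹`. The two transpositions
make a 3-cycle. No other cubie of the near face is brought to the far side, so for them the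
conjugates cancel. -/
theorem exists_corner_twist (hk : 2 ≤ k) {a b c : Fin n} (hab : a ≠ b) (hac : a ≠ c) (hbc : b ≠ c)
    {p : Pos n k} (ha : IsOuter (p a)) (hb : IsOuter (p b)) (hc : IsOuter (p c)) :
    ∃ g ∈ turnGroup n k, Sends g p p (Equiv.swap a c * Equiv.swap a b) ∧
      ∀ r, r a = p a → r ≠ p → Sends g r r 1 := by
  obtain ⟨R, hR, hRp, hR1, -, hR2⟩ := exists_turn_flip hab (sameAbs_of_isOuter ha hb)
  obtain ⟨F, hF, hFp, hF1, -, hF2⟩ := exists_turn_flip hac (sameAbs_of_isOuter ha hc)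
  have hD1 : ∀ r, r a ≠ (p a).rev →
      Sends (slice b c hbc (flip a p) * slice b c hbc (flip a p)) r r 1 := fun r hr => by
    have : ¬ InSlice b c (flip a p) r := fun h => hr (by simpa using h a hab hac)
    simpa using (slice_sends_of_not hbc this).mul (slice_sends_of_not hbc this)
  have hD2 := slice_mul_self_sends hbc (InSlice.refl b c (flip a p))
  have hD3 := slice_mul_self_sends hbc (p := flip a p) (r := flip b (flip c (flip a p)))
    fun x h1 h2 => by rw [flip_of_ne h1, flip_of_ne h2]
  have hD4 : flip b (flip c (flip b (flip c (flip a p)))) = flip a p := by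
    rw [flip_comm c b, flip_flip, flip_flip]
  rw [hD4] at hD3
  have hDm : slice b c hbc (flip a p) * slice b c hbc (flip a p) ∈ turnGroup n k :=
    mul_mem (slice_mem hbc) (slice_mem hbc)
  generalize slice b c hbc (flip a p) * slice b c hbc (flip a p) = D at *
  refine ⟨(F⁻¹ * D * F) * (R⁻¹ * D * R), mul_mem (mul_mem (mul_mem (inv_mem hF) hDm) hF)
    (mul_mem (mul_mem (inv_mem hR) hDm) hR), ?_, fun r hr hrp => ?_⟩
  · have h1 : Sends R _ _ 1 := hR1 (flip b (flip c (flip a p))) fun h => by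
      have := h c hac.symm hbc.symm
      rw [flip_of_ne hbc.symm, flip_self, flip_of_ne hac.symm] at this
      exact hc.rev_ne hk this
    have h2 : Sends F _ _ 1 := hF1 (flip b (flip c (flip a p))) fun h => by
      have := h b hab.symm hbc
      rw [flip_self, flip_of_ne hbc, flip_of_ne hab.symm] at this
      exact hb.rev_ne hk this
    have := ((hFp.inv.mul hD3).mul h2).mul ((h1.inv.mul hD2).mul hRp)
    simpa using this
  · simpa using (conj_half_turn_sends hk ha hF1 hF2 hD1 hr hrp).mul
      (conj_half_turn_sends hk ha hR1 hR2 hD1 hr hrp)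

theorem swap_mul_swap_mul_swap_of_ne {α : Type*} [DecidableEq α] {a b z : α} (hab : a ≠ b)
    (hbz : b ≠ z) : Equiv.swap a z * Equiv.swap b z * Equiv.swap a z = Equiv.swap a b := by
  rw [Equiv.swap_comm a z]
  exact Equiv.swap_mul_swap_mul_swap hbz hab.symm

/-- `R` carries `p` into the middle layer of the direction `a`, outside of which `E` is trivial. In
`R E² R² E R` the first `E` reflects coordinate `b`, so the `R²` misses the cubie, and `E²` then
restores `b`. What remains is a transposition conjugated by another. The other cubies of the face
never meet `E` and feel at most `R⁴ = 1`. -/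
theorem exists_edge_flip (hk : 2 ≤ k) {a b z : Fin n} (hab : a ≠ b) (haz : a ≠ z) (hbz : b ≠ z)
    {p : Pos n k} (ha : IsOuter (p a)) (hb : IsOuter (p b)) (hz : (p z).rev = p z) :
    ∃ g ∈ turnGroup n k, Sends g p p (Equiv.swap a b) ∧
      ∀ r, r a = p a → r ≠ p → Sends g r r 1 := by
  set p₁ := rot Fin.rev a z p with hp₁
  have h1a : p₁ a = p z := by simp [hp₁, rot, hz]
  have h1b : p₁ b = p b := by simp [hp₁, rot, hab.symm, hbz]
  have h1z : p₁ z = p a := by simp [hp₁, rot, haz.symm]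
  have hne : p a ≠ p z := fun h => ha.rev_ne hk (h ▸ hz)
  obtain ⟨E, hE, hEp, hE1, hE2, -⟩ := exists_turn_flip (p := p₁) hbz
    (by rw [h1b, h1z]; exact sameAbs_of_isOuter hb ha)
  have hE1' : ∀ r : Pos n k, r a ≠ p z → Sends E r r 1 := fun r hr => hE1 r fun h =>
    hr ((h a hab haz).trans h1a)
  set R := slice a z haz p with hR
  have hRR : ∀ r, InSlice a z p r → Sends (R * R) r (flip a (flip z r)) 1 := fun r hr =>
    slice_mul_self_sends haz hr
  refine ⟨R * (E * E) * (R * R) * E * R, ?_, ?_, fun r hr hrp => ?_⟩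
  · have hRm : R ∈ turnGroup n k := slice_mem haz
    exact mul_mem (mul_mem (mul_mem (mul_mem hRm (mul_mem hE hE)) (mul_mem hRm hRm)) hE) hRm
  · have h1 : Sends R p p₁ (Equiv.swap a z) := slice_sends haz (InSlice.refl a z p)
    have h2 : Sends R (flip b p₁) (flip b p₁) 1 := slice_sends_of_not haz fun h => by
      have := h b hab.symm hbz
      rw [flip_self, h1b] at this
      exact hb.rev_ne hk this
    have h3 := hE2 (flip b p₁) fun x hx _ => flip_of_ne hx _
    have h4 : flip b (flip z (flip b p₁)) = flip z p₁ := by rw [flip_comm z b, flip_flip]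
    rw [h4] at h3
    have h5 : Sends R (flip z p₁) (rot Fin.rev a z (flip z p₁)) (Equiv.swap a z) :=
      slice_sends haz fun x hx hx' => by
        rw [flip_of_ne hx']
        simp [hp₁, rot, hx, hx']
    have h6 : rot Fin.rev a z (flip z p₁) = p := by
      funext x
      by_cases h1 : x = a
      · subst h1
        simp [rot, h1z]
      · by_cases h2 : x = z
        · subst h2
          simp [rot, haz.symm, flip_of_ne haz, h1a]
        · simp [rot, h1, h2, flip_of_ne h2, hp₁]
    rw [h6] at h5
    have := (((h5.mul h3).mul (h2.mul h2)).mul hEp).mul h1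
    simpa [swap_mul_swap_mul_swap_of_ne hab hbz] using this
  · by_cases h : InSlice a z p r
    · have hrz : r z ≠ p z := fun h' => hrp (h.eq hr h')
      have h1 : Sends R r (rot Fin.rev a z r) (Equiv.swap a z) := slice_sends haz h
      have h2 : Sends E (rot Fin.rev a z r) (rot Fin.rev a z r) 1 := hE1' _ fun h' => by
        apply hrz
        rw [← Fin.rev_inj, hz]
        simpa [rot] using h'
      have h3 := hRR _ (inSlice_rot h)
      have h4 : flip a (flip z (rot Fin.rev a z r)) = rot Fin.rev z a r := by
        funext x
        simp only [flip, Function.update_apply, rot]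
        split_ifs <;> simp_all
      rw [h4] at h3
      have h5 : Sends E (rot Fin.rev z a r) (rot Fin.rev z a r) 1 := hE1' _ fun h' => by
        apply hrz
        simpa [rot, haz] using h'
      have h6 : Sends R (rot Fin.rev z a r) (rot Fin.rev a z (rot Fin.rev z a r))
        (Equiv.swap a z) := slice_sends haz fun x hx hx' => by
          simpa [rot, hx, hx'] using h x hx hx'
      rw [rot_rot Fin.rev_rev haz.symm] at h6
      simpa using (((h6.mul (h5.mul h5)).mul h3).mul h2).mul h1
    · have h1 : Sends R r r 1 := slice_sends_of_not haz h
      have h2 : Sends E r r 1 := hE1' r (by rw [hr]; exact hne)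
      simpa using (((h1.mul (h2.mul h2)).mul (h1.mul h1)).mul h2).mul h1

/-- An exchange of two outer coordinates together with two inner ones. -/
theorem exists_double_swap {x y u w : Fin n} (hxy : x ≠ y) (hxw : x ≠ w)
    (hwu : w ≠ u) (hxu : x ≠ u) {p : Pos n k} (h : SameAbs (p x) (p y))
    (h' : SameAbs (p w) (p u)) :
    ∃ g ∈ turnGroup n k, Sends g p p (Equiv.swap w u * Equiv.swap x y) ∧
      ∀ r, ¬ InSlice x y p r → ¬ InSlice w u (flip x p) r → ¬ InSlice x w p r →
        Sends g r r 1 := by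
  obtain ⟨S, hS, hSp, hS1, -, -⟩ := exists_turn_flip hxy h
  obtain ⟨W, hW, hWp, hW1, -, -⟩ := exists_turn_flip (p := flip x p) hwu
    (by rwa [flip_of_ne hxw.symm, flip_of_ne hxu.symm])
  -- `S` reflects the factor at `x` and `W` the one at `w`. The half turn in the plane `x, w` undoes
  -- both reflections without permuting coordinates.
  refine ⟨slice x w hxw p * slice x w hxw p * W * S,
    mul_mem (mul_mem (mul_mem (slice_mem hxw) (slice_mem hxw)) hW) hS, ?_, fun r h1 h2 h3 => ?_⟩
  · have h1 := slice_mul_self_sends hxw (p := p) (r := flip w (flip x p)) fun y hy hy' => by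
      rw [flip_of_ne hy', flip_of_ne hy]
    rw [flip_flip, flip_flip] at h1
    simpa using (h1.mul hWp).mul hSp
  · have h4 := slice_sends_of_not hxw h3
    simpa using ((h4.mul h4).mul (hW1 r h2)).mul (hS1 r h1)

/-- The commutator of two turns of layers that have only one cubie in common is a cycle of three
cubies. -/
theorem exists_three_cycle {i j i' j' : Fin n} (hij : i ≠ j) (hij' : i' ≠ j') (h1 : i ≠ i')
    (h2 : i ≠ j') (h3 : j ≠ i') (h4 : j ≠ j') {p : Pos n k} (hp : rot Fin.rev i' j' p ≠ p) :
    ∃ h ∈ turnGroup n k, (∃ ρ, Sends h p (rot Fin.rev i j p) ρ) ∧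
      ∀ r, r ≠ p → r ≠ rot Fin.rev i j p → r ≠ rot Fin.rev i' j' p → Sends h r r 1 := by
  have disj : ∀ {r}, InSlice i j p r → InSlice i' j' p r → r = p := fun h h' =>
    h.eq (h' i h1 h2) (h' j h3 h4)
  have inv_in : ∀ {a b : Fin n} {r}, InSlice a b p r → InSlice a b p (rot Fin.rev b a r) :=
    fun h => (inSlice_rot h.swap).swap
  have inv_sends : ∀ {a b : Fin n} (hab : a ≠ b) {r}, InSlice a b p r →
      Sends (slice a b hab p) (rot Fin.rev b a r) r (Equiv.swap a b) := fun hab r hr => by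
    have := slice_sends hab (inv_in hr)
    rwa [rot_rot Fin.rev_rev hab.symm] at this
  refine ⟨slice i j hij p * slice i' j' hij' p * (slice i j hij p)⁻¹ * (slice i' j' hij' p)⁻¹,
    mul_mem (mul_mem (mul_mem (slice_mem _) (slice_mem _)) (inv_mem (slice_mem _)))
      (inv_mem (slice_mem _)), ⟨Equiv.swap i j * Equiv.swap i' j' * 1⁻¹ * (Equiv.swap i' j')⁻¹, ?_⟩,
    fun r hr hr1 hr2 => ?_⟩
  · have ht := inv_sends hij' (InSlice.refl i' j' p)
    have hs : Sends (slice i j hij p) (rot Fin.rev j' i' p) _ 1 :=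
      slice_sends_of_not hij fun h => by
        have h5 := disj h (inv_in (InSlice.refl i' j' p))
        apply hp
        rw [← h5, rot_rot Fin.rev_rev hij'.symm, h5]
    exact (((slice_sends hij (InSlice.refl i j p)).mul ht).mul hs.inv).mul ht.inv
  · by_cases hS : InSlice i j p r
    · have ht : Sends (slice i' j' hij' p) r r 1 := slice_sends_of_not hij' fun h => hr (disj hS h)
      have ht' : Sends (slice i' j' hij' p) (rot Fin.rev j i r) _ 1 :=
        slice_sends_of_not hij' fun h => hr1 <| by
          rw [← disj (inv_in hS) h, rot_rot Fin.rev_rev hij.symm]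
      have hs := inv_sends hij hS
      simpa using ((hs.mul ht').mul hs.inv).mul ht.inv
    · have hs := slice_sends_of_not hij hS
      by_cases hT : InSlice i' j' p r
      · have hs' : Sends (slice i j hij p) (rot Fin.rev j' i' r) _ 1 :=
          slice_sends_of_not hij fun h => hr2 <| by
            rw [← disj h (inv_in hT), rot_rot Fin.rev_rev hij'.symm]
        have ht := inv_sends hij' hT
        simpa using ((hs.mul ht).mul hs'.inv).mul ht.inv
      · have ht := slice_sends_of_not hij' hT
        simpa using ((hs.mul ht).mul hs.inv).mul ht.inv

/-! ### Cubies of one class are related -/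

theorem exists_ne_ne_of_nodup {α : Type*} {a b c : α} (hab : a ≠ b) (hac : a ≠ c) (hbc : b ≠ c)
    (i j : α) : ∃ x, (x = a ∨ x = b ∨ x = c) ∧ x ≠ i ∧ x ≠ j := by
  by_contra! h
  have h1 := h a (by simp)
  have h2 := h b (by simp)
  have h3 := h c (by simp)
  by_cases ha : a = i <;> by_cases hb : b = i <;> grind

/-- A turn of one layer, whose plane does not contain the direction `a`, as the second factor of
the commutator. -/
theorem mem_realizable_of_face [NeZero n] {a i j : Fin n} (hij : i ≠ j) (hai : a ≠ i)
    (haj : a ≠ j) {p : Pos n k} (hp : rot Fin.rev i j p ≠ p) {g : Equiv.Perm (Facelet n k)}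
    (hg : g ∈ turnGroup n k) {π : Equiv.Perm (Fin n)} (hgp : Sends g p p π)
    (hgr : ∀ r, r a = p a → r ≠ p → Sends g r r 1) {σ : Equiv.Perm (Outer p)}
    (hσ : ∀ x : Outer p, π x = σ x) : σ ∈ realizable {p, rot Fin.rev i j p} p := by
  refine mem_realizable_of_disjoint hg (slice_mem hij) hgp (slice_sends hij (InSlice.refl i j p))
    hp.symm (fun r hr => ?_) hσ
  by_cases h : InSlice i j p r
  · exact Or.inl (hgr r (h a hai haj) hr)
  · exact Or.inr (slice_sends_of_not hij h)

open Classical in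
-- 3-cycles generate the alternating group, and one of the three coordinates moved by a 3-cycle lies
-- off the plane `i, j`. A corner twist based at that coordinate fixes the rest of a face that
-- contains the whole slice of the turn.
theorem mem_realizable_of_even [NeZero n] (hk : 2 ≤ k) {i j : Fin n} (hij : i ≠ j)
    {p : Pos n k} (hp : rot Fin.rev i j p ≠ p) {σ : Equiv.Perm (Outer p)}
    (hσ : Equiv.Perm.sign σ = 1) : σ ∈ realizable {p, rot Fin.rev i j p} p := by
  have h := Equiv.Perm.mem_alternatingGroup.2 hσ
  rw [← Equiv.Perm.closure_three_cycles_eq_alternating] at h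
  refine (Subgroup.closure_le _).2 ?_ h
  intro τ hτ
  have hτ : τ.IsThreeCycle := hτ
  obtain ⟨a, ha⟩ : τ.support.Nonempty := by
    rw [← Finset.card_pos, hτ.card_support]
    norm_num
  have hnd := hτ.nodup_iff_mem_support.2 ha
  simp only [List.nodup_cons, List.mem_cons, List.not_mem_nil, or_false, not_or, not_false_eq_true,
    List.nodup_nil, and_true] at hnd
  obtain ⟨x, hx, hxi, hxj⟩ := exists_ne_ne_of_nodup
    (Subtype.coe_injective.ne hnd.1.1) (Subtype.coe_injective.ne hnd.1.2)
    (Subtype.coe_injective.ne hnd.2) i j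
  have hx' : ∃ y : Outer p, y.1 = x ∧ y ∈ τ.support := by
    rcases hx with rfl | rfl | rfl
    · exact ⟨_, rfl, ha⟩
    · exact ⟨_, rfl, by simpa using ha⟩
    · exact ⟨_, rfl, by simpa using ha⟩
  obtain ⟨y, rfl, hy⟩ := hx'
  have hτe := hτ.eq_swap_mul_swap_iff_mem_support.2 hy
  have hnd := hτ.nodup_iff_mem_support.2 hy
  simp only [List.nodup_cons, List.mem_cons, List.not_mem_nil, or_false, not_or, not_false_eq_true,
    List.nodup_nil, and_true] at hnd
  generalize h1 : τ y = b at *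
  generalize h2 : τ b = c at *
  obtain ⟨g, hg, hgp, hgr⟩ := exists_corner_twist hk
    (Subtype.coe_injective.ne hnd.1.1) (Subtype.coe_injective.ne hnd.1.2)
    (Subtype.coe_injective.ne hnd.2) y.2 b.2 c.2
  refine mem_realizable_of_face hij hxi hxj hp hg hgp hgr fun z => ?_
  -- Rewrites `swap y b * swap b c` as `swap y c * swap y b`, the form that the corner twist
  -- produces.
  have hperm := Equiv.mul_swap_eq_swap_mul (Equiv.swap y.1 b.1) b.1 c.1
  rw [Equiv.swap_apply_right, Equiv.swap_apply_of_ne_of_ne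
    (Subtype.coe_injective.ne (Ne.symm hnd.1.2)) (Subtype.coe_injective.ne (Ne.symm hnd.2))]
    at hperm
  rw [hτe, ← hperm, Equiv.Perm.mul_apply, Equiv.Perm.mul_apply,
    Subtype.coe_injective.swap_apply, Subtype.coe_injective.swap_apply]

theorem rot_ne_of_isOuter_iff_not {i j : Fin n} (hij : i ≠ j) {p : Pos n k}
    (h : IsOuter (p i) ↔ ¬ IsOuter (p j)) : rot Fin.rev i j p ≠ p := by
  intro h'
  have h1 := congrFun h' j
  simp only [rot, hij.symm, if_false, if_true] at h1
  rw [h1] at h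
  grind

theorem IsOuter.not_fixed (hk : 2 ≤ k) {a : Fin k} (h : a.rev = a) : ¬ IsOuter a :=
  fun h' => h'.rev_ne hk h

theorem exists_ne_of_sign_ne_one {p : Pos n k} {σ : Equiv.Perm (Outer p)} (hσ : σ ≠ 1)
    (x : Fin n) : ∃ y, y ≠ x ∧ IsOuter (p y) := by
  by_contra! h
  refine hσ (Equiv.ext fun z => Subtype.ext ?_)
  have h1 : ∀ w : Outer p, w.1 = x := fun w => by
    by_contra hw
    exact h w.1 hw w.2
  rw [h1, h1]

open Classical in
/-- A turn that exchanges an outer factor with an inner one: an odd rotation of the cubie is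
effected. -/
theorem exists_odd_mem_realizable [NeZero n] (hk : 2 ≤ k) {i j : Fin n} (hij : i ≠ j)
    {p : Pos n k} {x v y : Fin n} (hxv : i = x ∧ j = v ∨ i = v ∧ j = x)
    (hx : IsOuter (p x)) (hv : ¬ IsOuter (p v)) (hyx : y ≠ x) (hy : IsOuter (p y))
    (hinner : (∃ z, (p z).rev = p z) ∨ ∃ u w, u ≠ w ∧ ¬ IsOuter (p u) ∧ ¬ IsOuter (p w) ∧
      SameAbs (p u) (p w)) :
    ∃ σ ∈ realizable {p, rot Fin.rev i j p} p, Equiv.Perm.sign σ = -1 := by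
  have ne_of : ∀ {a b : Fin n}, IsOuter (p a) → ¬ IsOuter (p b) → a ≠ b := fun h1 h2 h3 =>
    h2 (h3 ▸ h1)
  have hp : rot Fin.rev i j p ≠ p := rot_ne_of_isOuter_iff_not hij <| by
    rcases hxv with ⟨rfl, rfl⟩ | ⟨rfl, rfl⟩ <;> simp [hx, hv]
  have hyv := ne_of hy hv
  have hxv' := ne_of hx hv
  refine ⟨Equiv.swap ⟨x, hx⟩ ⟨y, hy⟩, ?_, Equiv.Perm.sign_swap fun h => hyx (congrArg
    Subtype.val h).symm⟩
  rcases hinner with ⟨z, hz⟩ | hinner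
  · have hz' := IsOuter.not_fixed hk hz
    obtain ⟨g, hg, hgp, hgr⟩ := exists_edge_flip hk hyx (ne_of hy hz') (ne_of hx hz') hy hx hz
    refine mem_realizable_of_face hij (a := y) ?_ ?_ hp hg hgp hgr fun t => ?_
    · rcases hxv with ⟨rfl, rfl⟩ | ⟨rfl, rfl⟩ <;> assumption
    · rcases hxv with ⟨rfl, rfl⟩ | ⟨rfl, rfl⟩ <;> assumption
    · rw [Equiv.swap_comm]
      exact Subtype.coe_injective.swap_apply (⟨x, hx⟩ : Outer p) ⟨y, hy⟩ t
  -- The roles of `u` and `w` are symmetric, so `w ≠ v` may be assumed. The planes `i, j` and `y, w`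
  -- then share no direction.
  · obtain ⟨u, w, huw, hu, hw, hs, hvw⟩ : ∃ u w, u ≠ w ∧ ¬ IsOuter (p u) ∧ ¬ IsOuter (p w) ∧
        SameAbs (p u) (p w) ∧ v ≠ w := by
      obtain ⟨u, w, huw, hu, hw, hs⟩ := hinner
      by_cases h : v = w
      · exact ⟨w, u, huw.symm, hw, hu, hs.symm, fun h' => huw (h'.symm.trans h)⟩
      · exact ⟨u, w, huw, hu, hw, hs, h⟩
    have hxw := ne_of hx hw
    have hxu := ne_of hx hu
    have hyw := ne_of hy hw
    have hyu := ne_of hy hu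
    obtain ⟨g, hg, hgp, hgr⟩ := exists_double_swap hyx.symm hxw huw.symm hxu
      (sameAbs_of_isOuter hx hy) hs.symm
    have hp' : rot Fin.rev y w p ≠ p := rot_ne_of_isOuter_iff_not hyw (by simp [hy, hw])
    obtain ⟨h, hh, ⟨ρ, hhp⟩, hhr⟩ := exists_three_cycle hij hyw (i := i) (j := j) (i' := y)
      (j' := w) (p := p) (by rcases hxv with ⟨rfl, rfl⟩ | ⟨rfl, rfl⟩; exacts [hyx.symm, hyv.symm])
      (by rcases hxv with ⟨rfl, rfl⟩ | ⟨rfl, rfl⟩ <;> assumption)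
      (by rcases hxv with ⟨rfl, rfl⟩ | ⟨rfl, rfl⟩; exacts [hyv.symm, hyx.symm])
      (by rcases hxv with ⟨rfl, rfl⟩ | ⟨rfl, rfl⟩ <;> assumption) hp'
    refine mem_realizable_of_disjoint hg hh hgp hhp hp.symm (fun r hr => ?_) fun t => ?_
    -- `h` moves at most three cubies. Comparing which coordinates are outer shows that the two
    -- besides `p` lie in none of the slices that `g` uses.
    · by_cases hr1 : r = rot Fin.rev i j p
      · have hr1x : ¬ IsOuter (r x) := by
          rcases hxv with ⟨rfl, rfl⟩ | ⟨rfl, rfl⟩ <;> subst hr1 <;>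
            simp [rot, isOuter_rev, hv, hij.symm]
        have hr1v : IsOuter (r v) := by
          rcases hxv with ⟨rfl, rfl⟩ | ⟨rfl, rfl⟩ <;> subst hr1 <;>
            simp [rot, isOuter_rev, hx, hij.symm]
        refine Or.inl (hgr r (fun h => ?_) (fun h => ?_) fun h => ?_)
        · exact hv (h v hxv'.symm hyv.symm ▸ hr1v)
        · have := h x hxw hxu
          rw [flip_self] at this
          rw [this, isOuter_rev] at hr1x
          exact hr1x hx
        · exact hv (h v hxv'.symm hvw ▸ hr1v)
      · by_cases hr2 : r = rot Fin.rev y w p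
        · have hr2y : ¬ IsOuter (r y) := by
            subst hr2
            simp [rot, isOuter_rev, hw]
          have hr2w : IsOuter (r w) := by
            subst hr2
            simp [rot, hy, hyw.symm]
          refine Or.inl (hgr r (fun h => ?_) (fun h => ?_) fun h => ?_)
          · exact hw (h w hxw.symm hyw.symm ▸ hr2w)
          · have := h y hyw hyu
            rw [flip_of_ne hyx] at this
            exact hr2y (this ▸ hy)
          · exact hr2y (h y hyx hyw ▸ hy)
        · exact Or.inr (hhr r hr hr1 hr2)
    · have h1 : (Equiv.swap x y) t.1 = (Equiv.swap (⟨x, hx⟩ : Outer p) ⟨y, hy⟩ t).1 :=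
        Subtype.coe_injective.swap_apply (⟨x, hx⟩ : Outer p) ⟨y, hy⟩ t
      have h2 := (Equiv.swap (⟨x, hx⟩ : Outer p) ⟨y, hy⟩ t).2
      rw [Equiv.Perm.mul_apply, h1]
      exact Equiv.swap_apply_of_ne_of_ne (ne_of h2 hw) (ne_of h2 hu)

open Classical in
-- If an odd rotation exists at all, some odd rotation is realizable across this turn, and dividing
-- by it leaves an even one.
theorem related_rot_of_isOuter_iff_not [NeZero n] (hk : 2 ≤ k) {i j : Fin n} (hij : i ≠ j)
    {p : Pos n k} (h : IsOuter (p i) ↔ ¬ IsOuter (p j)) : Related p (rot Fin.rev i j p) := by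
  intro g hg σ hσ
  have hp := rot_ne_of_isOuter_iff_not hij h
  rcases Int.units_eq_one_or (Equiv.Perm.sign σ) with h1 | h1
  · exact mem_realizable_of_even hk hij hp h1
  · have hinner := exists_inner_of_odd hg hσ h1
    have hne : σ ≠ 1 := by
      rintro rfl
      rw [Equiv.Perm.sign_one] at h1
      exact absurd h1 (by decide)
    obtain ⟨x, v, hxv, hx, hv⟩ : ∃ x v, (i = x ∧ j = v ∨ i = v ∧ j = x) ∧ IsOuter (p x) ∧
        ¬ IsOuter (p v) := by
      by_cases hi : IsOuter (p i)
      · exact ⟨i, j, Or.inl ⟨rfl, rfl⟩, hi, h.1 hi⟩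
      · exact ⟨j, i, Or.inr ⟨rfl, rfl⟩, by grind, hi⟩
    obtain ⟨y, hyx, hy⟩ := exists_ne_of_sign_ne_one hne x
    obtain ⟨τ, hτ, hτs⟩ := exists_odd_mem_realizable hk hij hxv hx hv hyx hy hinner
    have h2 : σ * τ⁻¹ ∈ realizable {p, rot Fin.rev i j p} p :=
      mem_realizable_of_even hk hij hp (by rw [map_mul, map_inv, h1, hτs]; decide)
    simpa using mul_mem h2 hτ

theorem rot_eq_rot_rot_rot {i j l : Fin n} (hij : i ≠ j) (hil : i ≠ l) (hjl : j ≠ l)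
    (p : Pos n k) :
    rot Fin.rev i j p = rot Fin.rev l j (rot Fin.rev i j (rot Fin.rev i l p)) := by
  funext x
  simp only [rot]
  split_ifs <;> simp_all

/-- The detour through `l` replaces the turn by three, each of which exchanges an outer factor with
an inner one. -/
theorem eq_or_related_rot_of_ne_type [NeZero n] (hk : 2 ≤ k) {i j l : Fin n} (hij : i ≠ j)
    {p : Pos n k} (h : IsOuter (p i) ↔ IsOuter (p j)) (hl : IsOuter (p l) ↔ ¬ IsOuter (p i)) :
    p = rot Fin.rev i j p ∨ Related p (rot Fin.rev i j p) := by
  have hil : i ≠ l := by rintro rfl; grind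
  have hjl : j ≠ l := by rintro rfl; grind
  rw [rot_eq_rot_rot_rot hij hil hjl]
  refine eq_or_related_trans (Or.inr (related_rot_of_isOuter_iff_not hk hil (by grind)))
    (eq_or_related_trans (Or.inr (related_rot_of_isOuter_iff_not hk hij ?_))
      (Or.inr (related_rot_of_isOuter_iff_not hk hjl.symm ?_)))
  · simp [rot, isOuter_rev, hij.symm, hjl]
    grind
  · simp [rot, isOuter_rev, hij.symm, hjl.symm, hil.symm]
    grind

open Classical in
-- The new case is that all factors are outer or all are inner. No odd rotation exists there, since
-- it would need factors of both kinds.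
theorem eq_or_related_rot [NeZero n] (hk : 2 ≤ k) {i j : Fin n} (hij : i ≠ j) (p : Pos n k) :
    p = rot Fin.rev i j p ∨ Related p (rot Fin.rev i j p) := by
  by_cases h : IsOuter (p i) ↔ IsOuter (p j)
  · by_cases hl : ∃ l, IsOuter (p l) ↔ ¬ IsOuter (p i)
    · obtain ⟨l, hl⟩ := hl
      exact eq_or_related_rot_of_ne_type hk hij h hl
    · by_cases hp : p = rot Fin.rev i j p
      · exact Or.inl hp
      refine Or.inr fun g hg σ hσ => ?_
      rcases Int.units_eq_one_or (Equiv.Perm.sign σ) with h1 | h1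
      · exact mem_realizable_of_even hk hij (Ne.symm hp) h1
      · exfalso
        have hinner := exists_inner_of_odd hg hσ h1
        have hne : σ ≠ 1 := by
          rintro rfl
          rw [Equiv.Perm.sign_one] at h1
          exact absurd h1 (by decide)
        obtain ⟨y, -, hy⟩ := exists_ne_of_sign_ne_one hne i
        obtain ⟨z, hz⟩ : ∃ z, ¬ IsOuter (p z) := by
          rcases hinner with ⟨z, hz⟩ | ⟨u, -, -, hu, -⟩
          · exact ⟨z, IsOuter.not_fixed hk hz⟩
          · exact ⟨u, hu⟩
        apply hl
        by_cases hi : IsOuter (p i)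
        · exact ⟨z, by grind⟩
        · exact ⟨y, by grind⟩
  · exact Or.inr (related_rot_of_isOuter_iff_not hk hij (by grind))

theorem Sends.eq_or_related [NeZero n] (hk : 2 ≤ k) {g : Equiv.Perm (Facelet n k)}
    (hg : g ∈ turnGroup n k) {p q : Pos n k} {π : Equiv.Perm (Fin n)} (h : Sends g p q π) :
    p = q ∨ Related p q := by
  obtain ⟨w, rfl⟩ := exists_wordPerm hg
  clear hg
  induction w generalizing p π with
  | nil => exact Or.inl ((Sends.one p).unique_pos h)
  | cons τ w ih =>
    obtain ⟨r, ρ, hr, hr'⟩ : ∃ r ρ, Sends (facePerm τ) p r ρ ∧ (p = r ∨ Related p r) := by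
      by_cases hτ : τ.InLayer p
      · exact ⟨_, _, facePerm_sends_of_inLayer hτ, eq_or_related_rot hk τ.ne p⟩
      · exact ⟨_, _, facePerm_sends_of_not_inLayer hτ, Or.inl rfl⟩
    obtain ⟨q', ρ', hq, -⟩ := exists_sends (wordPerm_mem w) r
    obtain rfl := h.unique_pos (hq.mul hr)
    exact eq_or_related_trans hr' (ih hq)

/-- A commutator of rotations of a cubie is effected without change of any other cubie. -/
theorem commutator_mem_realizable [NeZero n] (hk : 2 ≤ k) {p : Pos n k}
    {g h : Equiv.Perm (Facelet n k)} (hg : g ∈ turnGroup n k) (hh : h ∈ turnGroup n k)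
    {σ τ : Equiv.Perm (Outer p)} (hσ : HasEffect g p σ) (hτ : HasEffect h p τ) :
    σ * τ * σ⁻¹ * τ⁻¹ ∈ realizable {p} p := by
  by_cases hne : σ = 1
  · subst hne
    simp [one_mem]
  obtain ⟨x, -, hx⟩ := exists_ne_of_sign_ne_one hne 0
  obtain ⟨y, hyx, hy⟩ := exists_ne_of_sign_ne_one hne x
  have key : ∀ {a b : Fin n}, a ≠ b → IsOuter (p a) → SameAbs (p a) (p b) → ∃ i j, ∃ _ : i ≠ j,
      rot Fin.rev i j p = flip a p := by
    intro a b hab ha h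
    rcases h with h | h
    · exact ⟨a, b, hab, rot_eq_flip h⟩
    · exact ⟨b, a, hab.symm, rot_eq_flip' hab h⟩
  have hflip : ∀ {a}, IsOuter (p a) → flip a p ≠ p := fun {a} ha h => by
    have := congrFun h a
    rw [flip_self] at this
    exact ha.rev_ne hk this
  -- The reflections of `p` in `y` and in `x` are two different positions, each reached from `p` by
  -- one turn because outer factors agree up to reflection.
  obtain ⟨i, j, hij, h1⟩ := key hyx hy (sameAbs_of_isOuter hy hx)
  obtain ⟨i', j', hij', h2⟩ := key hyx.symm hx (sameAbs_of_isOuter hx hy)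
  have h3 := (eq_or_related_rot hk hij p).resolve_left (by rw [h1]; exact (hflip hy).symm)
  have h4 := (eq_or_related_rot hk hij' p).resolve_left (by rw [h2]; exact (hflip hx).symm)
  refine mem_realizable_singleton_of_commutator ?_ (h3 g hg σ hσ) (h4 h hh τ hτ)
  rw [h1, h2]
  intro h5
  have := congrFun h5 x
  rw [flip_self, flip_of_ne hyx.symm] at this
  exact hx.rev_ne hk this.symm

/-! ### States of the puzzle in terms of facelets -/

theorem Cell.Fits.isSeg_of_not_isOuter {a : Fin k} {c : Cell k} (h : c.Fits a)
    (ha : ¬ IsOuter a) : c.IsSeg := by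
  cases c with
  | seg j => trivial
  | bot => exact ha (Or.inl h)
  | top => exact ha (Or.inr h)

/-- For `k ≥ 2` no unit segment touches both ends of `[0, k]`, so at most one boundary point fits.
-/
theorem Cell.Fits.eq (hk : 2 ≤ k) {a : Fin k} {c d : Cell k} (hc : c.Fits a) (hd : d.Fits a)
    (h : c.IsSeg ↔ d.IsSeg) : c = d := by
  cases c <;> cases d <;> simp_all [Cell.Fits, Cell.IsSeg] <;> omega

/-- With `m` outer factors in `p`, the `n - m` inner factors of the face are all segments. It has `n
+ 1 - m` segments in total, which leaves exactly one among the outer factors. -/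
theorem existsUnique_outer_isSeg {p : Pos n k} {A : Fin n → Cell k}
    (hA : IsOrientationFace p A) : ∃! x : Outer p, (A x).IsSeg := by
  classical
  obtain ⟨h1, h2⟩ := hA
  unfold outerCount count at h2
  have h3 := Finset.card_filter_add_card_filter_not (s := Finset.univ.filter fun x => (A x).IsSeg)
    (fun x => IsOuter (p x))
  have h4 := Finset.card_filter_add_card_filter_not (s := (Finset.univ : Finset (Fin n)))
    (fun x => IsOuter (p x))
  have h5 : ((Finset.univ.filter fun x => (A x).IsSeg).filter fun x => ¬ IsOuter (p x)) =
      Finset.univ.filter fun x => ¬ IsOuter (p x) := by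
    ext x
    simp only [Finset.mem_filter, Finset.mem_univ, true_and, and_iff_right_iff_imp]
    exact (h1 x).isSeg_of_not_isOuter
  rw [h5] at h3
  rw [Finset.card_univ, Fintype.card_fin] at h4
  have h6 : ((Finset.univ.filter fun x => (A x).IsSeg).filter fun x => IsOuter (p x)).card = 1 := by
    convert (by omega : ((Finset.univ.filter fun x => (A x).IsSeg).filter
      fun x => IsOuter (p x)).card = 1)
  obtain ⟨x, hx⟩ := Finset.card_eq_one.1 h6
  have h7 : ∀ y, (A y).IsSeg ∧ IsOuter (p y) ↔ y = x := fun y => by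
    rw [← Finset.mem_singleton, ← hx]
    simp
  have h8 := (h7 x).2 rfl
  exact ⟨⟨x, h8.2⟩, h8.1, fun y hy => Subtype.ext ((h7 y).1 ⟨hy, y.2⟩)⟩

/-- The outer coordinate in which an orientation face is a segment. -/
noncomputable def faceCoord {p : Pos n k} (A : OFace p) : Outer p :=
  (existsUnique_outer_isSeg A.2).choose

theorem isSeg_iff_faceCoord {p : Pos n k} (A : OFace p) (x : Outer p) :
    (A.1 x).IsSeg ↔ x = faceCoord A := by
  have h := (existsUnique_outer_isSeg A.2).choose_spec
  exact ⟨fun hx => h.2 x hx, fun hx => hx ▸ h.1⟩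

theorem face_eq_of_faceCoord_eq (hk : 2 ≤ k) {p q : Pos n k} (hpq : p = q) {A : OFace p}
    {B : OFace q} (h : (faceCoord A).1 = (faceCoord B).1) : A.1 = B.1 := by
  subst hpq
  funext x
  refine (A.2.1 x).eq hk (B.2.1 x) ?_
  by_cases hx : IsOuter (p x)
  · rw [isSeg_iff_faceCoord A ⟨x, hx⟩, isSeg_iff_faceCoord B ⟨x, hx⟩, Subtype.ext h]
  · exact iff_of_true ((A.2.1 x).isSeg_of_not_isOuter hx) ((B.2.1 x).isSeg_of_not_isOuter hx)

theorem faceCoord_congr {p q : Pos n k} (hpq : p = q) {A : OFace p}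
    {B : OFace q} (h : A.1 = B.1) : (faceCoord A).1 = (faceCoord B).1 := by
  subst hpq
  rw [Subtype.ext h]

/-- Reflection keeps segments segments, so the marked coordinate simply follows the swap. -/
theorem facePerm_faceCoord (τ : Turn n k) {p : Pos n k} (A : OFace p) :
    facePerm τ (p, (faceCoord A).1) = (τ.move p, (faceCoord (τ.moveFace p A)).1) := by
  have hA := (isSeg_iff_faceCoord A _).2 rfl
  by_cases h : τ.InLayer p
  · have hm : τ.move p = rot Fin.rev τ.i τ.j p := if_pos h
    rw [facePerm_sends_of_inLayer h]
    refine Prod.ext hm.symm ?_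
    have hw : (τ.moveFace p A).1 = rot Cell.opp τ.i τ.j A.1 := by
      change τ.moveWord p A.1 = _
      rw [Turn.moveWord, if_pos h]
      rfl
    have ho : IsOuter (τ.move p (Equiv.swap τ.i τ.j (faceCoord A).1)) := by
      rw [hm, rot_apply_swap _ τ.ne]
      split_ifs
      · exact (isOuter_rev _).2 (faceCoord A).2
      · exact (faceCoord A).2
    have := (isSeg_iff_faceCoord (τ.moveFace p A) ⟨_, ho⟩).1 (by
      rw [hw, rot_apply_swap _ τ.ne]
      split_ifs
      · exact (Cell.isSeg_opp _).2 hA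
      · exact hA)
    rw [← this]
  · have hm : τ.move p = p := if_neg h
    rw [facePerm_sends_of_not_inLayer h]
    refine Prod.ext hm.symm (faceCoord_congr hm.symm ?_)
    change _ = τ.moveWord p A.1
    rw [Turn.moveWord, if_neg h]
    rfl

theorem wordPerm_fst (S : State n k) (w : Combination n k) {m : ℕ} (c : TrivClass n k m)
    (x : Fin n) : (wordPerm w ((S.place m c).1, x)).1 = ((S.perform w).place m c).1 := by
  induction w generalizing S x with
  | nil => rfl
  | cons τ w ih => exact ih (S.turn τ) _

theorem wordPerm_faceCoord (S : State n k) (w : Combination n k) {m : ℕ} (c : TrivClass n k m)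
    (s : Fin m) : wordPerm w ((S.place m c).1, (faceCoord (S.face m c s)).1) =
      (((S.perform w).place m c).1, (faceCoord ((S.perform w).face m c s)).1) := by
  induction w generalizing S with
  | nil => rfl
  | cons τ w ih =>
    refine Eq.trans ?_ (ih (S.turn τ))
    exact congrArg (wordPerm w) (facePerm_faceCoord τ (S.face m c s))

variable {S : State n k} {w : Combination n k} {m : ℕ} {c : TrivClass n k m}

theorem Sends.place_eq [NeZero n] {q : Pos n k} {π : Equiv.Perm (Fin n)}
    (h : Sends (wordPerm w) (S.place m c).1 q π) : ((S.perform w).place m c).1 = q := by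
  rw [← wordPerm_fst S w c 0, h]

theorem HasEffect.fixesPlace [NeZero n] {σ : Equiv.Perm (Outer (S.place m c).1)}
    (h : HasEffect (wordPerm w) (S.place m c).1 σ) : FixesPlace S w c := by
  obtain ⟨π, h1, -⟩ := h
  exact Subtype.ext h1.place_eq

theorem HasEffect.faceCoord_eq {σ : Equiv.Perm (Outer (S.place m c).1)}
    (h : HasEffect (wordPerm w) (S.place m c).1 σ) (s : Fin m) :
    (faceCoord ((S.perform w).face m c s)).1 = (σ (faceCoord (S.face m c s))).1 := by
  obtain ⟨π, h1, h2⟩ := h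
  have := congrArg Prod.snd (wordPerm_faceCoord S w c s)
  rw [h1, h2] at this
  exact this.symm

theorem HasEffect.fixesState [NeZero n] (hk : 2 ≤ k)
    (h : HasEffect (wordPerm w) (S.place m c).1 1) : FixesState S w c :=
  ⟨h.fixesPlace, fun s =>
    face_eq_of_faceCoord_eq hk (congrArg Subtype.val h.fixesPlace) (h.faceCoord_eq s)⟩

theorem Careful.isCarefulOrientation [NeZero n] (hk : 2 ≤ k) {X : Set (TrivClass n k m)}
    (h : Careful (wordPerm w) ((fun c => (S.place m c).1) '' X)) : IsCarefulOrientation S w X := by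
  refine ⟨fun c _ => ?_, fun m' c hc => ?_⟩
  · obtain ⟨σ, hσ⟩ := h.exists_effect (S.place m c).1
    exact hσ.fixesPlace
  · refine (h.trivial _ ?_).fixesState hk
    rintro ⟨x, hx, hxc⟩
    -- The number of outer factors of a position recovers the trivial class of the cubie in it.
    have hm : m' = m := by
      rw [← (S.place m' c).2, ← (S.place m x).2]
      exact congrArg outerCount hxc.symm
    subst hm
    exact hc ⟨x, hx, congrArg Subtype.val ((S.place m' ).injective (Subtype.ext hxc))⟩

/-! ### Numbers of faces versus outer coordinates -/

variable (S c) in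
/-- The permutation `z` of the numbers of the orientation faces of the cubie `c` corresponds to
the permutation `σ` of the outer coordinates of its position. -/
def Corresponds (z : Equiv.Perm (Fin m)) (σ : Equiv.Perm (Outer (S.place m c).1)) : Prop :=
  ∀ s, faceCoord (S.face m c (z s)) = σ (faceCoord (S.face m c s))

namespace Corresponds

variable {y z : Equiv.Perm (Fin m)} {σ τ : Equiv.Perm (Outer (S.place m c).1)}

theorem one : Corresponds S c 1 1 := fun _ => rfl

theorem mul (hy : Corresponds S c y σ) (hz : Corresponds S c z τ) :
    Corresponds S c (y * z) (σ * τ) := fun s => by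
  rw [Equiv.Perm.mul_apply, hy, hz, Equiv.Perm.mul_apply]

theorem inv (hz : Corresponds S c z σ) : Corresponds S c z⁻¹ σ⁻¹ := fun s => by
  rw [Equiv.Perm.eq_inv_iff_eq, ← hz]
  simp

end Corresponds

theorem exists_effect_of_mem_dependentGroup [NeZero n] {z : Equiv.Perm (Fin m)}
    (hz : z ∈ dependentGroup S c) : ∃ g ∈ turnGroup n k, ∃ σ,
      HasEffect g (S.place m c).1 σ ∧ Corresponds S c z σ := by
  induction hz using Subgroup.closure_induction with
  | mem z hz =>
    obtain ⟨w, hw, hwz⟩ := hz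
    obtain ⟨q, π, h1, -⟩ := exists_sends (wordPerm_mem w) (S.place m c).1
    obtain rfl : (S.place m c).1 = q := by rw [← h1.place_eq, hw]
    refine ⟨wordPerm w, wordPerm_mem w, _, h1.hasEffect (wordPerm_mem w), fun s => Subtype.ext ?_⟩
    rw [← (h1.hasEffect (wordPerm_mem w)).faceCoord_eq]
    exact faceCoord_congr (congrArg Subtype.val hw.symm) (hwz s).symm
  | one => exact ⟨1, one_mem _, 1, HasEffect.one _, Corresponds.one⟩
  | mul y z _ _ ihy ihz =>
    obtain ⟨g, hg, σ, h1, h2⟩ := ihy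
    obtain ⟨h, hh, τ, h3, h4⟩ := ihz
    exact ⟨g * h, mul_mem hg hh, σ * τ, h1.mul h3, h2.mul h4⟩
  | inv z _ ih =>
    obtain ⟨g, hg, σ, h1, h2⟩ := ih
    exact ⟨g⁻¹, inv_mem hg, σ⁻¹, h1.inv, h2.inv⟩

open scoped commutatorElement in
theorem exists_mem_realizable_of_mem_commutator [NeZero n] (hk : 2 ≤ k) {z : Equiv.Perm (Fin m)}
    (hz : z ∈ ⁅dependentGroup S c, dependentGroup S c⁆) :
    ∃ σ ∈ realizable {(S.place m c).1} (S.place m c).1, Corresponds S c z σ := by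
  rw [Subgroup.commutator_def] at hz
  induction hz using Subgroup.closure_induction with
  | mem z hz =>
    obtain ⟨x, hx, y, hy, rfl⟩ := hz
    obtain ⟨g, hg, σ, h1, h2⟩ := exists_effect_of_mem_dependentGroup hx
    obtain ⟨h, hh, τ, h3, h4⟩ := exists_effect_of_mem_dependentGroup hy
    exact ⟨_, commutator_mem_realizable hk hg hh h1 h3, ((h2.mul h4).mul h2.inv).mul h4.inv⟩
  | one => exact ⟨1, one_mem _, Corresponds.one⟩
  | mul y z _ _ ihy ihz =>
    obtain ⟨σ, h1, h2⟩ := ihy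
    obtain ⟨τ, h3, h4⟩ := ihz
    exact ⟨σ * τ, mul_mem h1 h3, h2.mul h4⟩
  | inv z _ ih =>
    obtain ⟨σ, h1, h2⟩ := ih
    exact ⟨σ⁻¹, inv_mem h1, h2.inv⟩

/-- `φ` reads the number of a face from its place, through the inverse of `face`. Precomposing
`face` with `z⁻¹` therefore multiplies `φ` by `z` on the left, which is why `z⁻¹` is the rotation to
be realized. -/
theorem orientationPerm_eq_mul (R : CorrectOrientation n k) {S' : State n k}
    {z : Equiv.Perm (Fin m)} (hplace : S'.place m c = S.place m c)
    (hface : ∀ s, (S'.face m c s).1 = (S.face m c (z⁻¹ s)).1) :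
    orientationPerm R S' c = z * orientationPerm R S c := by
  refine Equiv.ext fun s => ?_
  change (S'.face m c).symm (R m (S'.place m c) s) = z ((S.face m c).symm (R m (S.place m c) s))
  rw [Equiv.symm_apply_eq]
  apply Subtype.ext
  rw [hface, hplace]
  simp

theorem exists_combination_of_mem_realizable [NeZero n] (hk : 2 ≤ k) (R : CorrectOrientation n k)
    {X : Set (TrivClass n k m)} {z : Equiv.Perm (Fin m)}
    {σ : Equiv.Perm (Outer (S.place m c).1)}
    (hσ : σ ∈ realizable ((fun c => (S.place m c).1) '' X) (S.place m c).1)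
    (hz : Corresponds S c z⁻¹ σ) : ∃ w : Combination n k, IsCarefulOrientation S w X ∧
      orientationPerm R (S.perform w) c = z * orientationPerm R S c := by
  obtain ⟨g, hg, hgσ⟩ := hσ
  obtain ⟨w, rfl⟩ := exists_wordPerm hg.mem
  refine ⟨w, hg.isCarefulOrientation hk, orientationPerm_eq_mul R hgσ.fixesPlace fun s => ?_⟩
  refine face_eq_of_faceCoord_eq hk (congrArg Subtype.val hgσ.fixesPlace) ?_
  rw [hgσ.faceCoord_eq, hz]

end Rubik

theorem mainTheorem6 (n k : ℕ) (hn : 3 ≤ n) (hk : 2 ≤ k)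
    (R : Rubik.CorrectOrientation n k) (S : Rubik.State n k) (m : ℕ) :
    (∀ a b : Rubik.TrivClass n k m, a ≠ b → Rubik.SameClass S a b →
      ∀ z ∈ Rubik.dependentGroup S a, ∃ w : Rubik.Combination n k,
        Rubik.IsCarefulOrientation S w {a, b} ∧
        Rubik.orientationPerm R (S.perform w) a = z * Rubik.orientationPerm R S a) ∧
    (∀ a : Rubik.TrivClass n k m,
      ∀ z ∈ ⁅Rubik.dependentGroup S a, Rubik.dependentGroup S a⁆, ∃ w : Rubik.Combination n k,
        Rubik.IsCarefulOrientation S w {a} ∧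
        Rubik.orientationPerm R (S.perform w) a = z * Rubik.orientationPerm R S a) := by
  have : NeZero n := ⟨by omega⟩
  refine ⟨fun a b hab ⟨v, hv⟩ z hz => ?_, fun a z hz => ?_⟩
  · obtain ⟨q, π, h1, -⟩ := Rubik.exists_sends (Rubik.wordPerm_mem v) (S.place m a).1
    obtain rfl : (S.place m b).1 = q := by rw [← h1.place_eq, hv]
    have hrel := (h1.eq_or_related hk (Rubik.wordPerm_mem v)).resolve_left fun h =>
      hab ((S.place m).injective (Subtype.ext h))
    obtain ⟨g, hg, σ, h2, h3⟩ := Rubik.exists_effect_of_mem_dependentGroup (inv_mem hz)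
    refine Rubik.exists_combination_of_mem_realizable hk R (σ := σ) ?_ h3
    rw [Set.image_pair]
    exact hrel g hg σ h2
  · obtain ⟨σ, h1, h2⟩ := Rubik.exists_mem_realizable_of_mem_commutator hk (inv_mem hz)
    refine Rubik.exists_combination_of_mem_realizable hk R (σ := σ) ?_ h2
    rw [Set.image_singleton]
    exact h1
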